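/- Let $n\ge 0$ and let $G$ be a finitely generated group. A set $\Omega\subset\mathbb{RP}^n$ is \emph{properly convex} if it is open, any two of its points are contained in a segment of a projective line that lies in $\Omega$, and its closure contains no projective line. Let $\mathcal C(G)\subset \mathrm{Hom}(G,\mathrm{PGL}(n+1,\mathbb R))$ be the set of all representations $\rho$ for which there is a non-empty (equivalently, $n$-dimensional) properly convex set $\Omega\subset\mathbb{RP}^n$ with $\rho(g)\Omega=\Omega$ for all $g\in G$; no discreteness or faithfulness is assumed. Let $$\mathcal X(G)=\mathrm{Hom}(G,\mathrm{PGL}(n+1,\mathbb R))/\!/\mathrm{PGL}(n+1,\mathbb R)$$ be the character variety: the set of $\mathbb R$-algebra homomorphisms $R\to\mathbb R$, where $R$ is the ring of conjugation-invariant regular functions on the real algebraic set $\mathrm{Hom}(G,\mathrm{PGL}(n+1,\mathbb R))$ (that is, the set of real points of the affine GIT quotient), with the Euclidean topology, i.e. the coarsest topology for which all evaluations at elements of $R$ are continuous. (The regular functions on $\mathrm{Hom}(G,\mathrm{PGL}(n+1,\mathbb R))$ are the real algebra generated by $\rho\mapsto f(\rho(g))$ with $g\in G$ and $f$ a regular function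 on the algebraic group $\mathrm{PGL}(n+1,\mathbb R)$, i.e. a function whose pull-back to $\mathrm{GL}(n+1,\mathbb R)$ has the form $p/\det^k$ with $p$ a polynomial in the matrix entries and $k\ge 0$.) Let $\chi:\mathrm{Hom}(G,\mathrm{PGL}(n+1,\mathbb R))\to\mathcal X(G)$ be the projection, sending $\rho$ to evaluation at $\rho$. Then $\chi(\mathcal C(G))$ is a closed subset of $\mathcal X(G)$. -/

import Mathlib

open scoped LinearAlgebra.Projectivization MatrixGroups

noncomputable section

namespace ConvexProjective

/-- Real projective space `ℝPⁿ`, the set of lines through the origin of `ℝⁿ⁺¹`. -/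
abbrev RP (n : ℕ) : Type := ℙ ℝ (Fin (n + 1) → ℝ)

/-- The group `PGL(n+1,ℝ)`, the quotient of `GL(n+1,ℝ)` by the scalar matrices. -/
abbrev PGL (n : ℕ) : Type := Matrix.ProjGenLinGroup (Fin (n + 1)) ℝ

/-- The quotient topology coming from `ℝⁿ⁺¹ \ {0}`. -/
instance instTopologicalSpaceRP (n : ℕ) : TopologicalSpace (RP n) :=
  TopologicalSpace.coinduced
    (fun v : {v : Fin (n + 1) → ℝ // v ≠ 0} => (Projectivization.mk ℝ v.1 v.2 : RP n)) inferInstance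

/-- A projective line: all points of `ℝPⁿ` lying in some two-dimensional linear subspace. -/
def IsProjectiveLine {n : ℕ} (L : Set (RP n)) : Prop :=
  ∃ W : Submodule ℝ (Fin (n + 1) → ℝ), Module.finrank ℝ W = 2 ∧ L = {x | x.submodule ≤ W}

/-- Any two points of `Ω` are the endpoints of a segment of a projective line contained in `Ω`.
Such a segment is the projection of a straight segment of `ℝⁿ⁺¹` that misses the origin. -/
def IsConvex {n : ℕ} (Ω : Set (RP n)) : Prop :=
  ∀ p ∈ Ω, ∀ q ∈ Ω, ∃ (v w : Fin (n + 1) → ℝ) (hv : v ≠ 0) (hw : w ≠ 0),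
    Projectivization.mk ℝ v hv = p ∧ Projectivization.mk ℝ w hw = q ∧
      ∀ u ∈ segment ℝ v w, ∃ hu : u ≠ 0, Projectivization.mk ℝ u hu ∈ Ω

/-- A properly convex subset of `ℝPⁿ`: open, convex, and its closure contains no projective line. -/
structure IsProperlyConvex {n : ℕ} (Ω : Set (RP n)) : Prop where
  isOpen : IsOpen Ω
  convex : IsConvex Ω
  no_line : ∀ L : Set (RP n), IsProjectiveLine L → ¬ L ⊆ closure Ω

/-- The representation variety `Hom(G, PGL(n+1,ℝ))`. -/
abbrev Rep (G : Type*) [Group G] (n : ℕ) : Type _ := G →* PGL n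

/-- `𝒞(G)`: the representations whose image preserves a properly convex set of dimension `n`.
As properly convex sets are open, having dimension `n` means being non-empty. -/
def convexReps (G : Type*) [Group G] (n : ℕ) : Set (Rep G n) :=
  {ρ | ∃ Ω : Set (RP n), IsProperlyConvex Ω ∧ Ω.Nonempty ∧
    ∀ g : G, (fun x => ρ g • x) '' Ω = Ω}

/-- The regular functions on the affine algebraic group `PGL(n+1,ℝ)`: their pull-backs to
`GL(n+1,ℝ)` are of the form `p / det ^ k` with `p` a polynomial in the matrix entries. -/
def IsRegularFunction {n : ℕ} (f : PGL n → ℝ) : Prop :=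
  ∃ (p : MvPolynomial (Fin (n + 1) × Fin (n + 1)) ℝ) (k : ℕ), ∀ A : GL (Fin (n + 1)) ℝ,
    f (Matrix.ProjGenLinGroup.mk A) =
      MvPolynomial.eval (fun ij => (A : Matrix (Fin (n + 1)) (Fin (n + 1)) ℝ) ij.1 ij.2) p /
        (A : Matrix (Fin (n + 1)) (Fin (n + 1)) ℝ).det ^ k

/-- The coordinate ring of the real algebraic set `Hom(G, PGL(n+1,ℝ))`, generated by the
functions `ρ ↦ f (ρ g)` with `g ∈ G` and `f` regular on `PGL(n+1,ℝ)`. -/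
def coordinateRing (G : Type*) [Group G] (n : ℕ) : Subalgebra ℝ (Rep G n → ℝ) :=
  Algebra.adjoin ℝ
    {F | ∃ (g : G) (f : PGL n → ℝ), IsRegularFunction f ∧ F = fun ρ => f (ρ g)}

/-- The conjugation action of `PGL(n+1,ℝ)`: `(h · ρ)(g) = h ρ(g) h⁻¹`. -/
def conjRep {G : Type*} [Group G] {n : ℕ} (h : PGL n) (ρ : Rep G n) : Rep G n :=
  (MulAut.conj h).toMonoidHom.comp ρ

/-- The ring of conjugation invariant regular functions on `Hom(G, PGL(n+1,ℝ))`. -/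
def invariantRing (G : Type*) [Group G] (n : ℕ) : Subalgebra ℝ (Rep G n → ℝ) where
  carrier := {F | F ∈ coordinateRing G n ∧
    ∀ (h : PGL n) (ρ : Rep G n), F (conjRep h ρ) = F ρ}
  mul_mem' := fun ha hb => ⟨mul_mem ha.1 hb.1, fun h ρ => by
    simp only [Pi.mul_apply, ha.2 h ρ, hb.2 h ρ]⟩
  add_mem' := fun ha hb => ⟨add_mem ha.1 hb.1, fun h ρ => by
    simp only [Pi.add_apply, ha.2 h ρ, hb.2 h ρ]⟩
  algebraMap_mem' := fun r => ⟨Subalgebra.algebraMap_mem _ r, fun _ _ => rfl⟩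

/-- The character variety `𝒳(G) = Hom(G, PGL(n+1,ℝ)) // PGL(n+1,ℝ)`: the real points of the affine
GIT quotient, that is of the affine variety whose coordinate ring is the ring of invariants. -/
def CharacterVariety (G : Type*) [Group G] (n : ℕ) : Type _ :=
  invariantRing G n →ₐ[ℝ] ℝ

/-- The Euclidean topology on the real points: the coarsest one for which all the functions of the
coordinate ring are continuous. -/
instance instTopologicalSpaceCharacterVariety (G : Type*) [Group G] (n : ℕ) :
    TopologicalSpace (CharacterVariety G n) :=
  TopologicalSpace.induced
    (fun (x : invariantRing G n →ₐ[ℝ] ℝ) (F : invariantRing G n) => x F) inferInstance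

/-- The projection `χ : Hom(G, PGL(n+1,ℝ)) → 𝒳(G)`; a representation goes to the point at which
every invariant function takes the value it has at that representation. -/
def chi (G : Type*) [Group G] (n : ℕ) (ρ : Rep G n) : CharacterVariety G n :=
  (Pi.evalAlgHom ℝ (fun _ : Rep G n => ℝ) ρ).comp (invariantRing G n).val

end ConvexProjective

end

/-! ### Idempotents, reductive matrix sets and the trace form. -/

noncomputable section

namespace ConvexProjective

/-! A representation preserving a properly convex set lifts uniquely to matrices of determinant `±1`
that preserve one chosen sheet of the cone over that set. Hence the matter concerns linear
representations preserving a proper cone: closed, salient, with non-empty interior. The cones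
themselves may degenerate in a limit, so they are replaced by a closed condition that does not
mention them. If `A` preserves a proper cone, then `(A + A²)^m - (A²)^m` preserves it too, so the
spectral radius of `A²` is at most `‖A + A²‖`, and `|tr A²| ≤ dim · ‖A + A²‖`. This holds for every
`A` in the convex cone spanned by the image (`abs_trace_sq_le_of_preserves_cone`), and it survives
pointwise limits.

Now let the characters of such representations converge to `x`. The traces stay bounded. Conjugate
each representation so that its norm on generators is almost minimal. If these norms were unbounded,
a rescaled limit would have all its words traceless, hence could be conjugated close to zero,
against minimality (`exists_eventually_norm_le_of_trace_bounded`). Compactness then gives a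
representation over `x` satisfying the inequality. Minimizing the Frobenius norm on generators among
all of these makes it reductive (`exists_commuting_projections`).

For a reductive representation the inequality suffices. If the closed cone spanned by the image
contained a line, non-degeneracy of the trace form would produce an idempotent `e ≠ 0` with `-e` in
the cone; but `A = -e` has `A + A² = 0` and `tr A² = tr e ≠ 0` (`imageCone_salient`). From the
salient cone of matrices an invariant proper cone of vectors is built by enlarging, one step at a
time, an invariant set on which a linear functional dominates the norm
(`IsDominated.exists_span_lt`). The interior of that cone projects to the required properly convex
set. -/

open Polynomial in
theorem exists_idempotent_of_not_isNilpotent {ι : Type*} [Fintype ι] [DecidableEq ι]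
    {b : Matrix ι ι ℝ} (hb : ¬ IsNilpotent b) :
    ∃ q : ℝ[X], IsIdempotentElem (b * aeval b q) ∧ (b * aeval b q).trace ≠ 0 := by
  have hp : minpoly ℝ b ≠ 0 := minpoly.ne_zero (Matrix.isIntegral b)
  obtain ⟨s, hs, hXs⟩ := exists_eq_pow_rootMultiplicity_mul_and_not_dvd (minpoly ℝ b) hp 0
  set k := (minpoly ℝ b).rootMultiplicity 0
  rw [C_0, sub_zero] at hs hXs
  -- Bézout gives the Fitting projection onto the part where `b` is invertible. The exponent `k + 1`
  -- rather than `k` leaves a factor `b` to split off even when `b` is invertible, so the idempotent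
  -- is a polynomial in `b` without constant term.
  obtain ⟨u, v, huv⟩ : IsCoprime ((X : ℝ[X]) ^ (k + 1)) s :=
    ((irreducible_X (R := ℝ)).coprime_iff_not_dvd.2 hXs).pow_left
  have hmin : aeval b (X ^ k * s) = 0 := by rw [← hs]; exact minpoly.aeval ℝ b
  have he : b * aeval b (u * X ^ k) = aeval b (u * X ^ (k + 1)) := by
    rw [show u * X ^ (k + 1) = X * (u * X ^ k) by ring, map_mul (aeval b) X, aeval_X]
  have hidem : IsIdempotentElem (b * aeval b (u * X ^ k)) := by
    have h0 : aeval b (u * X ^ (k + 1) * (v * s)) = 0 := by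
      rw [show u * X ^ (k + 1) * (v * s) = (u * X * v) * (X ^ k * s) by ring, map_mul, hmin,
        mul_zero]
    rw [show v * s = 1 - u * X ^ (k + 1) by rw [← huv]; ring, map_mul, map_sub, map_one,
      mul_sub, mul_one, sub_eq_zero] at h0
    rw [IsIdempotentElem, he]
    exact h0.symm
  have hne : b * aeval b (u * X ^ k) ≠ 0 := by
    intro h0
    rw [he] at h0
    have h1 : aeval b (v * s) = 1 := by
      rw [show v * s = 1 - u * X ^ (k + 1) by rw [← huv]; ring, map_sub, h0, map_one, sub_zero]
    refine hb ⟨k, ?_⟩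
    have h2 : aeval b (X ^ k * (v * s)) = 0 := by
      rw [show X ^ k * (v * s) = v * (X ^ k * s) by ring, map_mul, hmin, mul_zero]
    rwa [map_mul, h1, mul_one, map_pow, aeval_X] at h2
  refine ⟨u * X ^ k, hidem, ?_⟩
  -- The trace of an idempotent is its rank, hence non-zero in characteristic zero.
  set e := b * aeval b (u * X ^ k)
  have hlin : IsIdempotentElem (Matrix.toLin' e) := by
    rw [IsIdempotentElem, Module.End.mul_eq_comp, ← Matrix.toLin'_mul, hidem]
  have htr := (LinearMap.IsIdempotentElem.isProj_range _ hlin).trace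
  rw [Matrix.trace_toLin'_eq] at htr
  rw [htr, Nat.cast_ne_zero, Ne, Submodule.finrank_eq_zero, LinearMap.range_eq_bot]
  simpa using hne

variable {ι : Type*} [Fintype ι] [DecidableEq ι]

/-- Every subspace invariant under a set of matrices is the image of a projection that commutes
with the set. -/
def IsReductive (S : Set (Matrix ι ι ℝ)) : Prop :=
  ∀ W : Submodule ℝ (ι → ℝ), (∀ a ∈ S, ∀ w ∈ W, a.mulVec w ∈ W) →
    ∃ π : Matrix ι ι ℝ, (∀ v, π.mulVec v ∈ W) ∧ (∀ w ∈ W, π.mulVec w = w) ∧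
      ∀ a ∈ S, Commute π a

theorem IsReductive.adjoin {S : Set (Matrix ι ι ℝ)} (hS : IsReductive S) :
    IsReductive (Algebra.adjoin ℝ S : Set (Matrix ι ι ℝ)) := by
  intro W hW
  obtain ⟨π, h1, h2, h3⟩ := hS W fun a ha => hW a (Algebra.subset_adjoin ha)
  refine ⟨π, h1, h2, fun a ha => ?_⟩
  have : Algebra.adjoin ℝ S ≤ Subalgebra.centralizer ℝ {π} :=
    Algebra.adjoin_le fun a ha => by
      rw [SetLike.mem_coe, Subalgebra.mem_centralizer_iff]
      rintro _ rfl
      exact h3 a ha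
  exact (Subalgebra.mem_centralizer_iff ℝ).1 (this ha) π rfl

/-- The trace form of a reductive matrix algebra is non-degenerate. -/
theorem IsReductive.eq_zero_of_trace_mul {A : Subalgebra ℝ (Matrix ι ι ℝ)}
    (hA : IsReductive (A : Set (Matrix ι ι ℝ))) {a : Matrix ι ι ℝ} (ha : a ∈ A)
    (h : ∀ b ∈ A, (a * b).trace = 0) : a = 0 := by
  have hnil : ∀ b ∈ A, IsNilpotent (a * b) := by
    intro b hb
    by_contra hn
    -- The idempotent is `a` times an element of `A`, so the hypothesis makes its trace vanish.
    obtain ⟨q, -, hq⟩ := exists_idempotent_of_not_isNilpotent hn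
    refine hq ?_
    rw [mul_assoc]
    refine h _ (A.mul_mem hb ?_)
    exact Algebra.adjoin_le (by simpa using A.mul_mem ha hb)
      (Polynomial.aeval_mem_adjoin_singleton ℝ (a * b))
  refine Matrix.toLin'.injective (LinearMap.ext fun v => ?_)
  rw [Matrix.toLin'_apply, map_zero, LinearMap.zero_apply]
  -- With `N = A·(a v)`, the vector `π v` equals `b (a v)` for some `b ∈ A`. Then `(a b)(a v) = a (π
  -- v) = π (a v) = a v`, so the nilpotent `a b` fixes `a v`.
  let N : Submodule ℝ (ι → ℝ) :=
    (Subalgebra.toSubmodule A).map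
      ((LinearMap.applyₗ (a.mulVec v)).comp (Matrix.toLin' (R := ℝ) (m := ι) (n := ι)).toLinearMap)
  have hN : ∀ w, w ∈ N ↔ ∃ c ∈ A, c.mulVec (a.mulVec v) = w := by
    intro w; simp [N, Matrix.toLin'_apply]
  obtain ⟨π, h1, h2, h3⟩ := hA N (by
    intro c hc w hw
    obtain ⟨c', hc', rfl⟩ := (hN w).1 hw
    exact (hN _).2 ⟨c * c', A.mul_mem hc hc', by rw [Matrix.mulVec_mulVec, Matrix.mulVec_mulVec,
      Matrix.mulVec_mulVec, mul_assoc]⟩)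
  obtain ⟨b, hb, hbv⟩ := (hN _).1 (h1 v)
  have hav : a.mulVec v ∈ N := (hN _).2 ⟨1, A.one_mem, by simp⟩
  have key : (a * b).mulVec (a.mulVec v) = a.mulVec v := by
    calc (a * b).mulVec (a.mulVec v) = (a * π).mulVec v := by
          rw [← Matrix.mulVec_mulVec, hbv, Matrix.mulVec_mulVec]
      _ = (π * a).mulVec v := by rw [(h3 a ha).eq]
      _ = a.mulVec v := by rw [← Matrix.mulVec_mulVec, h2 _ hav]
  obtain ⟨m, hm⟩ := hnil b hb
  have hpow : ∀ j : ℕ, ((a * b) ^ j).mulVec (a.mulVec v) = a.mulVec v := by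
    intro j
    induction j with
    | zero => simp
    | succ j ih => rw [pow_succ, ← Matrix.mulVec_mulVec, key, ih]
  rw [← hpow m, hm, Matrix.zero_mulVec]

theorem IsReductive.eq_zero_of_trace_mul_closure {S : Set (Matrix ι ι ℝ)} (hS : IsReductive S)
    {a : Matrix ι ι ℝ} (ha : a ∈ Algebra.adjoin ℝ S)
    (h : ∀ b ∈ Submonoid.closure S, (a * b).trace = 0) : a = 0 := by
  refine hS.adjoin.eq_zero_of_trace_mul ha fun b hb => ?_
  rw [← Subalgebra.mem_toSubmodule, Algebra.adjoin_eq_span] at hb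
  induction hb using Submodule.span_induction with
  | mem x hx => exact h x hx
  | zero => simp
  | add x y _ _ hx hy => rw [mul_add, Matrix.trace_add, hx, hy, add_zero]
  | smul c x _ hx => rw [mul_smul_comm, Matrix.trace_smul, hx, smul_zero]

/-! ### Linear functionals dominating the norm on salient cones. -/

section Separation

variable {E F : Type*} [NormedAddCommGroup E] [NormedSpace ℝ E] [FiniteDimensional ℝ E]
  [NormedAddCommGroup F] [NormedSpace ℝ F]

/-- A closed salient cone has a linear functional that dominates the norm. -/
theorem exists_norm_le_of_salient (Q : PointedCone ℝ E) (hQ : IsClosed (Q : Set E))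
    (hs : ∀ x ∈ Q, -x ∈ Q → x = 0) : ∃ f : E →L[ℝ] ℝ, ∀ q ∈ Q, ‖q‖ ≤ f q := by
  have := FiniteDimensional.proper_real E
  have hcpt : IsCompact ((Q : Set E) ∩ Metric.sphere 0 1) := (isCompact_sphere 0 1).inter_left hQ
  let C : ProperCone ℝ E := ⟨Q, hQ⟩
  have hsep : ∀ q ∈ (Q : Set E) ∩ Metric.sphere 0 1, ∃ f : E →L[ℝ] ℝ,
      (∀ x ∈ Q, 0 ≤ f x) ∧ 0 < f q := by
    rintro q ⟨hq, hq1⟩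
    have : -q ∉ C := fun h => by
      have := hs q hq h
      simp [this] at hq1
    obtain ⟨f, hf, hfq⟩ := C.hyperplane_separation_point this
    exact ⟨f, hf, by simpa using hfq⟩
  choose! f hf hfq using hsep
  obtain ⟨t, ht, hcov⟩ := hcpt.elim_nhds_subcover (fun q => {x | 0 < f q x}) fun q hq =>
    (isOpen_lt continuous_const (f q).continuous).mem_nhds (hfq q hq)
  -- Each functional is non-negative on `Q`, so a finite sum over a cover is positive on the whole
  -- compact unit slice.
  let g : E →L[ℝ] ℝ := ∑ q ∈ t, f q
  have hg : ∀ x ∈ (Q : Set E) ∩ Metric.sphere 0 1, 0 < g x := by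
    intro x hx
    obtain ⟨q, hq, hqx⟩ := Set.mem_iUnion₂.1 (hcov hx)
    simp only [g, sum_apply]
    exact Finset.sum_pos' (fun i hi => hf i (ht i hi) x hx.1) ⟨q, hq, hqx⟩
  obtain ⟨c, hc, hcg⟩ : ∃ c > 0, ∀ x ∈ (Q : Set E) ∩ Metric.sphere 0 1, c ≤ g x := by
    rcases ((Q : Set E) ∩ Metric.sphere 0 1).eq_empty_or_nonempty with h | h
    · exact ⟨1, one_pos, by simp [h]⟩
    · obtain ⟨x, hx, hmin⟩ := hcpt.exists_isMinOn h g.continuous.continuousOn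
      exact ⟨g x, hg x hx, fun y hy => hmin hy⟩
  refine ⟨c⁻¹ • g, fun q hq => ?_⟩
  rcases eq_or_ne q 0 with rfl | hq0
  · simp
  have hn : 0 < ‖q‖ := norm_pos_iff.2 hq0
  have := hcg (‖q‖⁻¹ • q) ⟨Q.smul_mem (inv_nonneg.2 hn.le) hq, by
    simp [norm_smul, hn.ne']⟩
  rw [map_smul, smul_eq_mul, inv_mul_eq_div, le_div_iff₀ hn] at this
  rw [smul_apply, smul_eq_mul, inv_mul_eq_div, le_div_iff₀ hc]
  linarith

/-- A linear image of a closed salient cone that meets the kernel trivially has a linear functional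
that dominates the norm. -/
theorem exists_norm_map_le_of_salient (Q : PointedCone ℝ E) (hQ : IsClosed (Q : Set E))
    (hs : ∀ x ∈ Q, -x ∈ Q → x = 0) (T : E →L[ℝ] F) (hT : ∀ q ∈ Q, T q = 0 → q = 0) :
    ∃ f : F →L[ℝ] ℝ, ∀ q ∈ Q, ‖T q‖ ≤ f (T q) := by
  have := FiniteDimensional.proper_real E
  obtain ⟨f, hf⟩ := exists_norm_le_of_salient Q hQ hs
  -- `B` is a compact convex base of `Q`. Its image avoids the origin and can be strictly separated
  -- from it, although `T` need not be injective on the whole space.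
  let B : Set E := (Q : Set E) ∩ {x | f x = 1}
  have hBcl : IsClosed B := hQ.inter (isClosed_eq f.continuous continuous_const)
  have hB : IsCompact B := by
    refine Metric.isCompact_of_isClosed_isBounded hBcl ?_
    refine (Metric.isBounded_closedBall (x := (0 : E)) (r := 1)).subset fun x hx => ?_
    rw [mem_closedBall_zero_iff, ← hx.2]
    exact hf x hx.1
  have hBc : Convex ℝ B := Q.convex.inter (convex_hyperplane f.toLinearMap.isLinear 1)
  have h0 : (0 : F) ∉ T '' B := by
    rintro ⟨x, hx, hTx⟩
    have := hx.2
    simp [hT x hx.1 hTx] at this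
  obtain ⟨g, u, hu, hg⟩ := geometric_hahn_banach_point_closed
    (hBc.is_linear_image T.toLinearMap.isLinear) (hB.image T.continuous).isClosed h0
  rw [map_zero] at hu
  have key : ∀ q ∈ Q, u * ‖q‖ ≤ g (T q) := by
    intro q hq
    rcases eq_or_ne q 0 with rfl | hq0
    · simp
    have hfq : 0 < f q := (norm_pos_iff.2 hq0).trans_le (hf q hq)
    have := hg (T ((f q)⁻¹ • q)) ⟨_, ⟨Q.smul_mem (inv_nonneg.2 hfq.le) hq, by
      simp [hfq.ne']⟩, rfl⟩
    rw [map_smul, map_smul, smul_eq_mul, inv_mul_eq_div, lt_div_iff₀ hfq] at this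
    exact (mul_le_mul_of_nonneg_left (hf q hq) hu.le).trans this.le
  refine ⟨(‖T‖ / u) • g, fun q hq => ?_⟩
  rw [smul_apply, smul_eq_mul, div_mul_eq_mul_div, le_div_iff₀ hu]
  calc ‖T q‖ * u ≤ (‖T‖ * ‖q‖) * u := by gcongr; exact T.le_opNorm q
    _ = ‖T‖ * (u * ‖q‖) := by ring
    _ ≤ ‖T‖ * g (T q) := by gcongr; exact key q hq

end Separation

end ConvexProjective

end

/-! ### Growth of powers and a Perron-Frobenius inequality. -/

noncomputable section

namespace ConvexProjective

open scoped Matrix.Norms.Operator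

variable {ι : Type*} [Fintype ι] [DecidableEq ι]

theorem le_of_forall_pow_mul_le {x b c C : ℝ} (hb : 0 ≤ b) (hc : 0 < c)
    (h : ∀ m : ℕ, x ^ m * c ≤ C * b ^ m) : x ≤ b := by
  by_contra! hlt
  rcases hb.eq_or_lt with rfl | hb
  · have := h 1
    simp only [pow_one, mul_zero] at this
    exact absurd this (not_le.2 (mul_pos hlt hc))
  · obtain ⟨m, hm⟩ := pow_unbounded_of_one_lt (C / c) ((one_lt_div hb).2 hlt)
    rw [div_pow, div_lt_div_iff₀ hc (pow_pos hb m)] at hm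
    exact absurd (h m) (not_le.2 hm)

theorem norm_pow_mulVec_le (B : Matrix ι ι ℝ) (v : ι → ℝ) (m : ℕ) :
    ‖(B ^ m).mulVec v‖ ≤ ‖B‖ ^ m * ‖v‖ := by
  induction m with
  | zero => simp
  | succ m ih =>
    rw [pow_succ', ← Matrix.mulVec_mulVec]
    calc _ ≤ ‖B‖ * ‖(B ^ m).mulVec v‖ := Matrix.linfty_opNorm_mulVec _ _
      _ ≤ ‖B‖ * (‖B‖ ^ m * ‖v‖) := by gcongr
      _ = _ := by ring

theorem exists_sub_mem_of_interior_nonempty {E : Type*} [NormedAddCommGroup E] [NormedSpace ℝ E]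
    (K : PointedCone ℝ E) (hi : (interior (K : Set E)).Nonempty) (v : E) :
    ∃ x ∈ K, ∃ y ∈ K, v = x - y := by
  obtain ⟨e, he⟩ := hi
  have hc : ContinuousAt (fun t : ℝ => e + t • v) 0 := by fun_prop
  have h1 : ∀ᶠ t : ℝ in nhds 0, e + t • v ∈ K :=
    hc.eventually (p := (· ∈ K)) (by
      simp only [zero_smul, add_zero]; exact mem_interior_iff_mem_nhds.1 he)
  obtain ⟨t, ht, ht0⟩ := ((h1.filter_mono nhdsWithin_le_nhds).and
    (self_mem_nhdsWithin : Set.Ioi (0 : ℝ) ∈ nhdsWithin 0 (Set.Ioi 0))).exists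
  have ht0 : 0 < t := ht0
  refine ⟨t⁻¹ • (e + t • v), K.smul_mem (by positivity) ht, t⁻¹ • e,
    K.smul_mem (by positivity) (interior_subset he), ?_⟩
  rw [smul_add, smul_smul, inv_mul_cancel₀ ht0.ne', one_smul, add_sub_cancel_left]

/-- A matrix whose powers grow at most like `b ^ m` has trace at most `(dim) * b`. -/
theorem abs_trace_le_of_growth (B : Matrix ι ι ℝ) {b : ℝ} (hb : 0 ≤ b)
    (h : ∀ v, ∃ C, ∀ m : ℕ, ‖(B ^ m).mulVec v‖ ≤ C * b ^ m) :
    |B.trace| ≤ Fintype.card ι * b := by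
  let f : ℝ →+* ℂ := algebraMap ℝ ℂ
  -- The growth bound, applied to the real and imaginary parts of a complex eigenvector, bounds the
  -- powers of each complex eigenvalue.
  have hroot : ∀ μ ∈ (B.map f).charpoly.roots, ‖μ‖ ≤ b := by
    intro μ hμ
    have hdet := Polynomial.isRoot_of_mem_roots hμ
    rw [Polynomial.IsRoot, Matrix.eval_charpoly] at hdet
    obtain ⟨z, hz0, hz⟩ := Matrix.exists_mulVec_eq_zero_iff.2 hdet
    rw [Matrix.sub_mulVec, sub_eq_zero] at hz
    have hz' : (B.map f).mulVec z = μ • z := by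
      rw [← hz]; ext i; simp [Matrix.scalar_apply, Matrix.mulVec_diagonal]
    have hpow : ∀ m : ℕ, ((B ^ m).map f).mulVec z = μ ^ m • z := by
      intro m
      induction m with
      | zero => simp
      | succ m ih =>
        rw [pow_succ, Matrix.map_mul, ← Matrix.mulVec_mulVec, hz', Matrix.mulVec_smul, ih,
          smul_smul, pow_succ']
    obtain ⟨j, hj⟩ := Function.ne_iff.1 hz0
    obtain ⟨C₁, hC₁⟩ := h fun i => (z i).re
    obtain ⟨C₂, hC₂⟩ := h fun i => (z i).im
    refine le_of_forall_pow_mul_le (c := ‖z j‖) (C := C₁ + C₂) hb (norm_pos_iff.2 hj) fun m => ?_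
    have hcoord : μ ^ m * z j = ((B ^ m).mulVec (fun i => (z i).re) j : ℝ) +
        ((B ^ m).mulVec (fun i => (z i).im) j : ℝ) * Complex.I := by
      have := congrFun (hpow m) j
      rw [Pi.smul_apply, smul_eq_mul] at this
      rw [← this]
      simp only [Matrix.mulVec, dotProduct, Matrix.map_apply, Complex.ofReal_sum,
        Finset.sum_mul, ← Finset.sum_add_distrib]
      refine Finset.sum_congr rfl fun i _ => ?_
      conv_lhs => rw [← Complex.re_add_im (z i)]
      simp only [f, Complex.coe_algebraMap, Complex.ofReal_mul]
      ring
    calc ‖μ‖ ^ m * ‖z j‖ = ‖μ ^ m * z j‖ := by rw [norm_mul, norm_pow]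
      _ ≤ ‖(B ^ m).mulVec (fun i => (z i).re)‖ + ‖(B ^ m).mulVec (fun i => (z i).im)‖ := by
          rw [hcoord]
          refine (norm_add_le _ _).trans (add_le_add ?_ ?_)
          · rw [Complex.norm_real]; exact norm_le_pi_norm _ j
          · rw [norm_mul, Complex.norm_I, mul_one, Complex.norm_real]; exact norm_le_pi_norm _ j
      _ ≤ (C₁ + C₂) * b ^ m := by rw [add_mul]; exact add_le_add (hC₁ m) (hC₂ m)
  have htr : f B.trace = (B.map f).charpoly.roots.sum := by
    rw [← Matrix.trace_eq_sum_roots_charpoly]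
    simp [Matrix.trace]
  have hn : |B.trace| = ‖f B.trace‖ := by simp [f]
  rw [hn, htr]
  calc _ ≤ ((B.map f).charpoly.roots.map norm).sum := norm_multiset_sum_le _
    _ ≤ Multiset.card ((B.map f).charpoly.roots.map norm) • b :=
        Multiset.sum_le_card_nsmul _ _ (by
          intro x hx
          obtain ⟨μ, hμ, rfl⟩ := Multiset.mem_map.1 hx
          exact hroot μ hμ)
    _ ≤ _ := by
        rw [Multiset.card_map, nsmul_eq_mul]
        gcongr
        exact ((B.map f).charpoly.card_roots').trans (Matrix.charpoly_natDegree_eq_dim _).le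

/-- A consequence of the Perron-Frobenius theorem for matrices that preserve a cone; it is a closed
condition that does not mention the cone. -/
theorem abs_trace_sq_le_of_preserves_cone (K : PointedCone ℝ (ι → ℝ))
    (hK : IsClosed (K : Set (ι → ℝ))) (hs : ∀ x ∈ K, -x ∈ K → x = 0)
    (hi : (interior (K : Set (ι → ℝ))).Nonempty) (A : Matrix ι ι ℝ)
    (hA : ∀ x ∈ K, A.mulVec x ∈ K) :
    |(A * A).trace| ≤ Fintype.card ι * ‖A + A * A‖ := by
  obtain ⟨f, hf⟩ := exists_norm_le_of_salient K hK hs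
  have hf0 : ∀ x ∈ K, 0 ≤ f x := fun x hx => (norm_nonneg x).trans (hf x hx)
  have hpow : ∀ (B : Matrix ι ι ℝ), (∀ x ∈ K, B.mulVec x ∈ K) → ∀ m : ℕ, ∀ x ∈ K,
      (B ^ m).mulVec x ∈ K := by
    intro B hB m
    induction m with
    | zero => simp
    | succ m ih => intro x hx; rw [pow_succ, ← Matrix.mulVec_mulVec]; exact ih _ (hB x hx)
  have hA2 : ∀ x ∈ K, (A * A).mulVec x ∈ K := fun x hx => by
    rw [← Matrix.mulVec_mulVec]; exact hA _ (hA x hx)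
  have hAA : ∀ x ∈ K, (A + A * A).mulVec x ∈ K := fun x hx => by
    rw [Matrix.add_mulVec]; exact K.add_mem (hA x hx) (hA2 x hx)
  -- In the order defined by `K`, `A * A ≤ A + A * A`, and this persists for powers; the monotone
  -- functional `f` then compares their growth.
  have hdiff : ∀ m : ℕ, ∀ x ∈ K, ((A + A * A) ^ m - (A * A) ^ m).mulVec x ∈ K := by
    intro m
    induction m with
    | zero => simp
    | succ m ih =>
      intro x hx
      have : (A + A * A) ^ (m + 1) - (A * A) ^ (m + 1) =
          (A + A * A) * ((A + A * A) ^ m - (A * A) ^ m) + A * (A * A) ^ m := by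
        rw [pow_succ', pow_succ']; noncomm_ring
      rw [this, Matrix.add_mulVec, ← Matrix.mulVec_mulVec, ← Matrix.mulVec_mulVec]
      exact K.add_mem (hAA _ (ih x hx)) (hA _ (hpow _ hA2 m x hx))
  have hgrow : ∀ x ∈ K, ∀ m : ℕ,
      ‖((A * A) ^ m).mulVec x‖ ≤ (‖f‖ * ‖x‖) * ‖A + A * A‖ ^ m := by
    intro x hx m
    have h1 := hf0 _ (hdiff m x hx)
    rw [Matrix.sub_mulVec, map_sub, sub_nonneg] at h1
    calc _ ≤ f (((A * A) ^ m).mulVec x) := hf _ (hpow _ hA2 m x hx)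
      _ ≤ f (((A + A * A) ^ m).mulVec x) := h1
      _ ≤ ‖f‖ * ‖((A + A * A) ^ m).mulVec x‖ := (le_abs_self _).trans (f.le_opNorm _)
      _ ≤ ‖f‖ * (‖A + A * A‖ ^ m * ‖x‖) := by gcongr; exact norm_pow_mulVec_le _ _ _
      _ = _ := by ring
  refine abs_trace_le_of_growth _ (norm_nonneg _) fun v => ?_
  obtain ⟨x, hx, y, hy, rfl⟩ := exists_sub_mem_of_interior_nonempty K hi v
  refine ⟨‖f‖ * ‖x‖ + ‖f‖ * ‖y‖, fun m => ?_⟩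
  rw [Matrix.mulVec_sub, add_mul]
  exact (norm_sub_le _ _).trans (add_le_add (hgrow x hx m) (hgrow y hy m))

end ConvexProjective

end

/-! ### Families of minimal norm under conjugation. -/

noncomputable section

namespace ConvexProjective

variable {ι : Type*} [Fintype ι] [DecidableEq ι]

theorem exists_symmetric_projection (W : Submodule ℝ (ι → ℝ)) :
    ∃ π : Matrix ι ι ℝ, π.transpose = π ∧ (∀ v, π.mulVec v ∈ W) ∧ ∀ w ∈ W, π.mulVec w = w := by
  let U : Submodule ℝ (EuclideanSpace ℝ ι) := W.comap (WithLp.linearEquiv 2 ℝ (ι → ℝ)).toLinearMap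
  let P : EuclideanSpace ℝ ι →ₗ[ℝ] EuclideanSpace ℝ ι := U.starProjection.toLinearMap
  let π : Matrix ι ι ℝ := Matrix.toEuclideanLin.symm P
  have hP : Matrix.toEuclideanLin π = P := Matrix.toEuclideanLin.apply_symm_apply P
  have hv : ∀ v : ι → ℝ, π.mulVec v = (P (WithLp.toLp 2 v)).ofLp := by
    intro v; rw [← hP, Matrix.toLpLin_apply]
  refine ⟨π, ?_, fun v => ?_, fun w hw => ?_⟩
  · have : π.IsHermitian := by
      rw [← Matrix.isSymmetric_toEuclideanLin_iff, hP]
      exact U.starProjection_isSymmetric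
    simpa [Matrix.IsHermitian, Matrix.conjTranspose_eq_transpose_of_trivial] using this
  · rw [hv]
    exact U.starProjection_apply_mem (WithLp.toLp 2 v)
  · rw [hv]
    have : P (WithLp.toLp 2 w) = WithLp.toLp 2 w :=
      Submodule.starProjection_eq_self_iff.2 (show WithLp.toLp 2 w ∈ U from hw)
    rw [this]

omit [DecidableEq ι] in
theorem trace_transpose_mul_self_eq_sum (X : Matrix ι ι ℝ) :
    (X.transpose * X).trace = ∑ j, ∑ i, X i j ^ 2 := by
  simp [Matrix.trace, Matrix.mul_apply, sq]

omit [DecidableEq ι] in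
theorem trace_transpose_mul_self_nonneg (X : Matrix ι ι ℝ) : 0 ≤ (X.transpose * X).trace := by
  rw [trace_transpose_mul_self_eq_sum]
  positivity

omit [DecidableEq ι] in
theorem eq_zero_of_trace_transpose_mul_self {X : Matrix ι ι ℝ}
    (h : (X.transpose * X).trace ≤ 0) : X = 0 := by
  have h0 := le_antisymm h (trace_transpose_mul_self_nonneg X)
  rw [trace_transpose_mul_self_eq_sum,
    Finset.sum_eq_zero_iff_of_nonneg fun _ _ => by positivity] at h0
  ext i j
  have h1 := h0 j (Finset.mem_univ j)
  rw [Finset.sum_eq_zero_iff_of_nonneg fun _ _ => by positivity] at h1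
  simpa using h1 i (Finset.mem_univ i)

omit [DecidableEq ι] in
theorem isCompact_trace_transpose_mul_self_le (R : ℝ) :
    IsCompact {X : Matrix ι ι ℝ | (X.transpose * X).trace ≤ R} := by
  have hbox : IsCompact (X := Matrix ι ι ℝ) (Set.univ.pi fun _ : ι => Set.univ.pi fun _ : ι =>
      Set.Icc (-(|R| + 1)) (|R| + 1)) :=
    isCompact_univ_pi fun _ => isCompact_univ_pi fun _ => isCompact_Icc
  refine hbox.of_isClosed_subset (isClosed_le (by fun_prop) continuous_const) fun X hX i _ j _ => ?_
  have hle : X i j ^ 2 ≤ R := by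
    refine le_trans ?_ (show (X.transpose * X).trace ≤ R from hX)
    rw [trace_transpose_mul_self_eq_sum]
    exact (Finset.single_le_sum (f := fun i => X i j ^ 2) (fun _ _ => by positivity)
      (Finset.mem_univ i)).trans
      (Finset.single_le_sum (f := fun j => ∑ i, X i j ^ 2) (fun _ _ => by positivity)
      (Finset.mem_univ j))
  have := le_abs_self R
  rw [Set.mem_Icc, ← abs_le]
  exact abs_le_of_sq_le_sq (by nlinarith [abs_nonneg R]) (by positivity)

/-- A closed conjugation invariant set of families of matrices contains a family of smallest
Frobenius norm; the orthogonal projection to an invariant subspace commutes with such a family. -/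
theorem exists_commuting_projections {κ : Type*} (Z : Set (κ → Matrix ι ι ℝ)) (hZ : IsClosed Z)
    (hne : Z.Nonempty)
    (hconj : ∀ h : (Matrix ι ι ℝ)ˣ, ∀ B ∈ Z, (fun k => h.1 * B k * (h⁻¹).1) ∈ Z) (S : Finset κ)
    (hcpt : ∀ R : ℝ, ∃ C : Set (κ → Matrix ι ι ℝ), IsCompact C ∧
      ∀ B ∈ Z, ∑ s ∈ S, ((B s).transpose * B s).trace ≤ R → B ∈ C) :
    ∃ B ∈ Z, ∀ W : Submodule ℝ (ι → ℝ), (∀ k, ∀ w ∈ W, (B k).mulVec w ∈ W) →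
      ∃ π : Matrix ι ι ℝ, (∀ v, π.mulVec v ∈ W) ∧ (∀ w ∈ W, π.mulVec w = w) ∧
        ∀ s ∈ S, Commute π (B s) := by
  obtain ⟨B₀, hB₀⟩ := hne
  let N : (κ → Matrix ι ι ℝ) → ℝ := fun B => ∑ s ∈ S, ((B s).transpose * B s).trace
  have hN : Continuous N := by fun_prop
  obtain ⟨C, hC, hCZ⟩ := hcpt (N B₀)
  have hcomp : IsCompact (Z ∩ {B | N B ≤ N B₀}) :=
    hC.of_isClosed_subset (hZ.inter (isClosed_le hN continuous_const))
      fun B hB => hCZ B hB.1 hB.2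
  obtain ⟨B, hB, hmin⟩ := hcomp.exists_isMinOn ⟨B₀, hB₀, le_refl (N B₀)⟩ hN.continuousOn
  have hmin' : ∀ B' ∈ Z, N B ≤ N B' := by
    intro B' hB'
    by_cases h : N B' ≤ N B₀
    · exact hmin ⟨hB', h⟩
    · exact hB.2.trans (not_le.1 h).le
  refine ⟨B, hB.1, fun W hW => ?_⟩
  obtain ⟨π, hsym, hπ, hπW⟩ := exists_symmetric_projection W
  refine ⟨π, hπ, hπW, ?_⟩
  have hidem : π * π = π := by
    refine Matrix.toLin'.injective (LinearMap.ext fun v => ?_)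
    rw [Matrix.toLin'_apply, Matrix.toLin'_apply, ← Matrix.mulVec_mulVec, hπW _ (hπ v)]
  have hπ1 : (1 - π) * π = 0 := by rw [sub_mul, hidem, one_mul, sub_self]
  have hπ2 : π * (1 - π) = 0 := by rw [mul_sub, hidem, mul_one, sub_self]
  have hidem' : (1 - π) * (1 - π) = 1 - π := by rw [mul_sub, hπ1, mul_one, sub_zero]
  have hinv : ∀ k, π * B k * π = B k * π := by
    intro k
    refine Matrix.toLin'.injective (LinearMap.ext fun v => ?_)
    rw [Matrix.toLin'_apply, Matrix.toLin'_apply, mul_assoc, ← Matrix.mulVec_mulVec,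
      ← Matrix.mulVec_mulVec, hπW _ (hW k _ (hπ v))]
  -- In blocks for the splitting by `π`, invariance of `W` makes `B k` block triangular: `D` is its
  -- block diagonal part and `O` its off-diagonal block.
  let D : κ → Matrix ι ι ℝ := fun k => B k * π + (B k - π * B k) * (1 - π)
  let O : κ → Matrix ι ι ℝ := fun k => π * B k * (1 - π)
  have hBDO : ∀ k, B k = D k + O k := by
    intro k; simp only [D, O]; noncomm_ring
  have hDZ : D ∈ Z := by
    have hlim : Filter.Tendsto (fun u : ℝ => fun k => D k + u • O k) (nhdsWithin 0 (Set.Ioi 0))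
        (nhds D) := by
      have : Continuous fun u : ℝ => fun k => D k + u • O k := by fun_prop
      have := this.tendsto 0
      simp only [zero_smul, add_zero] at this
      exact this.mono_left nhdsWithin_le_nhds
    refine hZ.mem_of_tendsto hlim ?_
    filter_upwards [self_mem_nhdsWithin] with u hu
    have hu : u ≠ 0 := ne_of_gt hu
    have hmul : ∀ a b : ℝ, a * b = 1 → (π + a • (1 - π)) * (π + b • (1 - π)) = 1 := by
      intro a b hab
      rw [add_mul, mul_add, mul_add, hidem, mul_smul_comm, hπ2, smul_zero, smul_mul_assoc, hπ1,
        smul_zero, smul_mul_smul_comm, hidem', hab, one_smul]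
      abel
    -- Conjugation by `π + u⁻¹(1 - π)` multiplies the off-diagonal block by `u` and fixes the
    -- diagonal ones, so `D` is a limit of conjugates as `u → 0`.
    convert hconj ⟨π + u⁻¹ • (1 - π), π + u • (1 - π), hmul _ _ (inv_mul_cancel₀ hu),
      hmul _ _ (mul_inv_cancel₀ hu)⟩ B hB.1 using 1
    funext k
    have h3 : (1 - π) * B k * π = 0 := by
      rw [sub_mul, sub_mul, one_mul, hinv, sub_self]
    change D k + u • O k = (π + u⁻¹ • (1 - π)) * B k * (π + u • (1 - π))
    rw [add_mul, add_mul, mul_add, smul_mul_assoc, smul_mul_assoc, mul_add, h3, mul_smul_comm,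
      mul_smul_comm, hinv, zero_add, smul_smul, inv_mul_cancel₀ hu, one_smul]
    simp only [D, O]
    rw [sub_mul 1 π (B k), one_mul]
    abel
  have horth : ∀ k, ((D k).transpose * O k).trace = 0 := by
    intro k
    have hD : D k = π * B k * π + (1 - π) * B k * (1 - π) := by
      simp only [D, hinv]; noncomm_ring
    have hDt : (D k).transpose * π = π * (B k).transpose * π := by
      rw [hD]
      simp only [Matrix.transpose_add, Matrix.transpose_mul, Matrix.transpose_sub,
        Matrix.transpose_one, hsym, add_mul]
      rw [mul_assoc (1 - π) _ π, mul_assoc _ (1 - π) π, hπ1, mul_zero, mul_zero, add_zero]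
      simp only [mul_assoc, hidem]
    have : (D k).transpose * O k = π * ((B k).transpose * π * B k * (1 - π)) := by
      rw [show (D k).transpose * O k = ((D k).transpose * π) * (B k * (1 - π)) by
        simp only [O, mul_assoc], hDt]
      simp only [mul_assoc]
    rw [this, Matrix.trace_mul_comm, mul_assoc, hπ1, mul_zero, Matrix.trace_zero]
  have hpyth : ∀ k, ((B k).transpose * B k).trace =
      ((D k).transpose * D k).trace + ((O k).transpose * O k).trace := by
    intro k
    have h : ∀ d o : Matrix ι ι ℝ, (d.transpose * o).trace = 0 →
        ((d + o).transpose * (d + o)).trace =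
          (d.transpose * d).trace + (o.transpose * o).trace := by
      intro d o hdo
      have h' : (o.transpose * d).trace = 0 := by
        rw [← Matrix.trace_transpose, Matrix.transpose_mul, Matrix.transpose_transpose, hdo]
      rw [Matrix.transpose_add, add_mul, mul_add, mul_add, Matrix.trace_add, Matrix.trace_add,
        Matrix.trace_add, hdo, h']
      ring
    rw [hBDO k]
    exact h _ _ (horth k)
  -- By Pythagoras, passing from `B` to `D` lowers the norm by that of `O`; minimality leaves no
  -- room for it.
  have hsum : ∑ s ∈ S, ((O s).transpose * O s).trace ≤ 0 := by
    have := hmin' D hDZ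
    simp only [N, hpyth, Finset.sum_add_distrib] at this
    linarith
  intro s hs
  have hO : π * B s * (1 - π) = 0 := by
    refine eq_zero_of_trace_transpose_mul_self (le_trans ?_ hsum)
    exact Finset.single_le_sum (f := fun s => ((O s).transpose * O s).trace)
      (fun _ _ => trace_transpose_mul_self_nonneg _) hs
  rw [mul_sub, mul_one, hinv, sub_eq_zero] at hO
  exact hO

open scoped Matrix.Norms.Operator in
/-- A finite family of matrices all of whose words are traceless can be conjugated arbitrarily close
to zero. -/
theorem exists_conj_norm_lt_of_trace_eq_zero {σ : Type*} [Fintype σ] (B : σ → Matrix ι ι ℝ)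
    (hB : ∀ (s : σ) (w : FreeMonoid σ), (B s * FreeMonoid.lift B w).trace = 0) {δ : ℝ}
    (hδ : 0 < δ) : ∃ h : (Matrix ι ι ℝ)ˣ, ∀ s, ‖h.1 * B s * (h⁻¹).1‖ < δ := by
  let c : (Matrix ι ι ℝ)ˣ → (σ → Matrix ι ι ℝ) → (σ → Matrix ι ι ℝ) :=
    fun h X s => h.1 * X s * (h⁻¹).1
  have hc : ∀ h, Continuous (c h) := fun h => by fun_prop
  have hlift : ∀ h X w, FreeMonoid.lift (c h X) w = h.1 * FreeMonoid.lift X w * (h⁻¹).1 := by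
    intro h X w
    induction w using FreeMonoid.inductionOn' with
    | one => simp
    | of_mul a w ih =>
      rw [map_mul, map_mul, ih, FreeMonoid.lift_eval_of, FreeMonoid.lift_eval_of]
      simp only [c, mul_assoc, Units.inv_mul_cancel_left]
  let Z : Set (σ → Matrix ι ι ℝ) := closure (Set.range fun h => c h B)
  have hconj : ∀ h, ∀ X ∈ Z, c h X ∈ Z := by
    intro h X hX
    refine map_mem_closure (hc h) hX ?_
    rintro _ ⟨h', rfl⟩
    refine ⟨h * h', ?_⟩
    funext s
    simp only [c, Units.val_mul, mul_inv_rev, mul_assoc]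
  have hcont : ∀ w : FreeMonoid σ, Continuous fun X : σ → Matrix ι ι ℝ => FreeMonoid.lift X w := by
    intro w
    induction w using FreeMonoid.inductionOn' with
    | one => simpa using continuous_const
    | of_mul a w ih =>
      simp only [map_mul, FreeMonoid.lift_eval_of]
      fun_prop
  have htr : ∀ X ∈ Z, ∀ (s : σ) (w : FreeMonoid σ), (X s * FreeMonoid.lift X w).trace = 0 := by
    intro X hX s w
    have hcl : IsClosed {X : σ → Matrix ι ι ℝ | (X s * FreeMonoid.lift X w).trace = 0} := by
      have := hcont w
      exact isClosed_eq (by fun_prop) continuous_const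
    refine closure_minimal ?_ hcl hX
    rintro _ ⟨h, rfl⟩
    change (h.1 * B s * (h⁻¹).1 * FreeMonoid.lift (c h B) w).trace = 0
    rw [hlift, show h.1 * B s * (h⁻¹).1 * (h.1 * FreeMonoid.lift B w * (h⁻¹).1) =
        h.1 * (B s * FreeMonoid.lift B w) * (h⁻¹).1 by
        simp only [mul_assoc, Units.inv_mul_cancel_left], Matrix.trace_mul_comm, ← mul_assoc,
      Units.inv_mul, one_mul, hB]
  obtain ⟨X, hX, hred⟩ := exists_commuting_projections Z isClosed_closure
    ⟨_, subset_closure ⟨1, rfl⟩⟩ hconj Finset.univ fun R =>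
      ⟨Set.univ.pi fun _ => {Y | (Y.transpose * Y).trace ≤ R},
        isCompact_univ_pi fun _ => isCompact_trace_transpose_mul_self_le R, fun Y _ hR s _ =>
          (Finset.single_le_sum (f := fun s => ((Y s).transpose * Y s).trace)
            (fun _ _ => trace_transpose_mul_self_nonneg _) (Finset.mem_univ s)).trans hR⟩
  have hXred : IsReductive (Set.range X) := by
    intro W hW
    obtain ⟨π, h1, h2, h3⟩ := hred W fun k => hW _ ⟨k, rfl⟩
    refine ⟨π, h1, h2, ?_⟩
    rintro _ ⟨s, rfl⟩
    exact h3 s (Finset.mem_univ s)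
  -- The trace conditions pass to the orbit closure, and its minimal element is reductive, so
  -- non-degeneracy of the trace form forces it to vanish. Thus zero is a limit of conjugates.
  have hX0 : X = 0 := by
    funext s
    refine hXred.eq_zero_of_trace_mul_closure (Algebra.subset_adjoin ⟨s, rfl⟩) fun b hb => ?_
    rw [← FreeMonoid.mrange_lift] at hb
    obtain ⟨w, rfl⟩ := hb
    exact htr X hX s w
  have hopen : IsOpen {Y : σ → Matrix ι ι ℝ | ∀ s, ‖Y s‖ < δ} := by
    simp only [Set.ofPred_forall]
    exact isOpen_iInter_of_finite fun s => isOpen_lt (by fun_prop) continuous_const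
  obtain ⟨_, hY, h, rfl⟩ := mem_closure_iff.1 hX _ hopen (by simp [hX0, hδ])
  exact ⟨h, hY⟩

end ConvexProjective

end

/-! ### From a salient cone of matrices to an invariant cone of vectors. -/

noncomputable section

namespace ConvexProjective

open scoped Matrix.Norms.Operator

variable {ι : Type*} [Fintype ι] [DecidableEq ι] {G : Type*} [Group G]

/-- The closed cone spanned by the image of a matrix representation. -/
def imageCone (r : G →* Matrix ι ι ℝ) : PointedCone ℝ (Matrix ι ι ℝ) :=
  (PointedCone.hull ℝ (Set.range r)).closure

theorem isClosed_imageCone (r : G →* Matrix ι ι ℝ) :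
    IsClosed (imageCone r : Set (Matrix ι ι ℝ)) := by
  rw [imageCone, PointedCone.coe_closure]; exact isClosed_closure

theorem apply_mem_imageCone (r : G →* Matrix ι ι ℝ) (g : G) : r g ∈ imageCone r := by
  rw [imageCone, PointedCone.mem_closure]
  exact subset_closure (PointedCone.subset_hull ⟨g, rfl⟩)

/-- A property that is closed and stable under conical combinations holds on the image cone as soon
as it holds on the image of the representation. -/
theorem mem_of_mem_imageCone {r : G →* Matrix ι ι ℝ} (C : PointedCone ℝ (Matrix ι ι ℝ))
    (hC : IsClosed (C : Set (Matrix ι ι ℝ))) (h : ∀ g, r g ∈ C) {p : Matrix ι ι ℝ}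
    (hp : p ∈ imageCone r) : p ∈ C := by
  rw [imageCone, PointedCone.mem_closure] at hp
  refine closure_minimal ?_ hC hp
  exact Submodule.span_le.2 (by rintro _ ⟨g, rfl⟩; exact h g)

theorem mul_mem_imageCone {r : G →* Matrix ι ι ℝ} {p q : Matrix ι ι ℝ} (hp : p ∈ imageCone r)
    (hq : q ∈ imageCone r) : p * q ∈ imageCone r := by
  have h1 : ∀ g, ∀ q ∈ imageCone r, r g * q ∈ imageCone r := by
    intro g q hq
    refine mem_of_mem_imageCone ((imageCone r).comap (LinearMap.mulLeft ℝ (r g)))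
      ((isClosed_imageCone r).preimage (f := fun x => r g * x) (by fun_prop)) (fun g' => ?_) hq
    rw [PointedCone.mem_comap, LinearMap.mulLeft_apply, ← map_mul]
    exact apply_mem_imageCone r _
  exact mem_of_mem_imageCone ((imageCone r).comap (LinearMap.mulRight ℝ q))
    ((isClosed_imageCone r).preimage (f := fun x => x * q) (by fun_prop)) (fun g => h1 g q hq) hp

theorem imageCone_le_adjoin {r : G →* Matrix ι ι ℝ} {p : Matrix ι ι ℝ} (hp : p ∈ imageCone r) :
    p ∈ Algebra.adjoin ℝ (Set.range r) :=
  mem_of_mem_imageCone (PointedCone.ofSubmodule (Subalgebra.toSubmodule (Algebra.adjoin ℝ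
    (Set.range r)))) (Submodule.closed_of_finiteDimensional
      (Subalgebra.toSubmodule (Algebra.adjoin ℝ (Set.range r))))
    (fun g => Algebra.subset_adjoin ⟨g, rfl⟩) hp

/-- A line in the cone would, after multiplication by a group element, have a non-nilpotent
direction `b`. The lineality space contains all positive powers of `b`, hence a non-zero idempotent
`e`, and `A = -e` violates `hPF`. -/
theorem imageCone_salient {r : G →* Matrix ι ι ℝ} (hr : IsReductive (Set.range r))
    (hPF : ∀ A ∈ imageCone r, |(A * A).trace| ≤ Fintype.card ι * ‖A + A * A‖)
    {x : Matrix ι ι ℝ} (hx : x ∈ imageCone r) (hnx : -x ∈ imageCone r) : x = 0 := by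
  by_contra hx0
  obtain ⟨g, hg⟩ : ∃ g, (x * r g).trace ≠ 0 := by
    by_contra! h
    refine hx0 (hr.eq_zero_of_trace_mul_closure (imageCone_le_adjoin hx) fun b hb => ?_)
    rw [← MonoidHom.coe_mrange, Submonoid.closure_eq] at hb
    obtain ⟨g, rfl⟩ := hb
    exact h g
  have hnil : ¬ IsNilpotent (x * r g) := fun h =>
    hg (Matrix.isNilpotent_trace_of_isNilpotent h).eq_zero
  obtain ⟨q, hq, htr⟩ := exists_idempotent_of_not_isNilpotent hnil
  set b := x * r g
  have hb : b ∈ imageCone r := mul_mem_imageCone hx (apply_mem_imageCone r g)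
  have hnb : -b ∈ imageCone r := by
    rw [← neg_mul]; exact mul_mem_imageCone hnx (apply_mem_imageCone r g)
  let L : Submodule ℝ (Matrix ι ι ℝ) :=
    { carrier := {a | a ∈ imageCone r ∧ -a ∈ imageCone r}
      add_mem' := fun {u v} hu hv => ⟨add_mem hu.1 hv.1, by
        rw [neg_add]; exact add_mem hu.2 hv.2⟩
      zero_mem' := ⟨zero_mem _, by rw [neg_zero]; exact zero_mem _⟩
      smul_mem' := fun c u hu => by
        rcases le_total 0 c with hc | hc
        · exact ⟨PointedCone.smul_mem _ hc hu.1, by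
            rw [← smul_neg]; exact PointedCone.smul_mem _ hc hu.2⟩
        · have hc' : 0 ≤ -c := neg_nonneg.2 hc
          refine ⟨?_, ?_⟩
          · rw [← neg_smul_neg]; exact PointedCone.smul_mem _ hc' hu.2
          · rw [← neg_smul]; exact PointedCone.smul_mem _ hc' hu.1 }
  have hbL : ∀ k : ℕ, b * b ^ k ∈ L := by
    intro k
    induction k with
    | zero => rw [pow_zero, mul_one]; exact ⟨hb, hnb⟩
    | succ k ih =>
      rw [pow_succ, ← mul_assoc]
      exact ⟨mul_mem_imageCone ih.1 hb, by rw [← neg_mul]; exact mul_mem_imageCone ih.2 hb⟩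
  have heL : b * Polynomial.aeval b q ∈ L := by
    rw [Polynomial.aeval_eq_sum_range, Finset.mul_sum]
    refine Submodule.sum_mem _ fun i _ => ?_
    rw [mul_smul_comm]
    exact L.smul_mem _ (hbL i)
  -- For `A = -e` the right-hand side vanishes while `A * A = e` has non-zero trace.
  have := hPF _ heL.2
  rw [neg_mul_neg, hq.eq, neg_add_cancel, norm_zero, mul_zero] at this
  exact htr (abs_eq_zero.1 (le_antisymm this (abs_nonneg _)))

/-- An invariant set of vectors whose norm is dominated by a linear functional. -/
def IsDominated (r : G →* Matrix ι ι ℝ) (X : Set (ι → ℝ)) : Prop :=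
  (∀ g, ∀ x ∈ X, (r g).mulVec x ∈ X) ∧ ∃ f : (ι → ℝ) →L[ℝ] ℝ, ∀ x ∈ X, ‖x‖ ≤ f x

/-- Writing `w` as a combination of elements of `X`, take for `e` the combination with the absolute
values of the coefficients. The same `e` serves every `g`. -/
theorem exists_norm_mulVec_le_of_mem_span {r : G →* Matrix ι ι ℝ} {X : Set (ι → ℝ)}
    (hX : ∀ g, ∀ x ∈ X, (r g).mulVec x ∈ X) {f : (ι → ℝ) →L[ℝ] ℝ} (hf : ∀ x ∈ X, ‖x‖ ≤ f x)
    {w : ι → ℝ} (hw : w ∈ Submodule.span ℝ X) :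
    ∃ e ∈ Submodule.span ℝ X, ∀ g, ‖(r g).mulVec w‖ ≤ f ((r g).mulVec e) := by
  induction hw using Submodule.span_induction with
  | mem x hx => exact ⟨x, Submodule.subset_span hx, fun g => hf _ (hX g x hx)⟩
  | zero => exact ⟨0, zero_mem _, by simp⟩
  | add x y _ _ hx hy =>
    obtain ⟨e, he, hxe⟩ := hx
    obtain ⟨e', he', hye⟩ := hy
    refine ⟨e + e', add_mem he he', fun g => ?_⟩
    rw [Matrix.mulVec_add, Matrix.mulVec_add, map_add]
    exact (norm_add_le _ _).trans (add_le_add (hxe g) (hye g))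
  | smul c x _ hx =>
    obtain ⟨e, he, hxe⟩ := hx
    refine ⟨|c| • e, Submodule.smul_mem _ _ he, fun g => ?_⟩
    rw [Matrix.mulVec_smul, Matrix.mulVec_smul, map_smul, norm_smul, Real.norm_eq_abs, smul_eq_mul]
    exact mul_le_mul_of_nonneg_left (hxe g) (abs_nonneg c)

/-- The norms of the restrictions of a representation to the span of a dominated set are dominated
as well. -/
theorem exists_norm_mul_projection_le {r : G →* Matrix ι ι ℝ} {X : Set (ι → ℝ)}
    (hX : ∀ g, ∀ x ∈ X, (r g).mulVec x ∈ X) {f : (ι → ℝ) →L[ℝ] ℝ} (hf : ∀ x ∈ X, ‖x‖ ≤ f x)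
    {π : Matrix ι ι ℝ} (hπ : ∀ v, π.mulVec v ∈ Submodule.span ℝ X) :
    ∃ e ∈ Submodule.span ℝ X, ∀ g, ‖r g * π‖ ≤ f ((r g).mulVec e) := by
  have h : ∀ j : ι, ∃ e ∈ Submodule.span ℝ X, ∀ g,
      ‖(r g).mulVec (π.mulVec (Pi.single j 1))‖ ≤ f ((r g).mulVec e) := fun j =>
    exists_norm_mulVec_le_of_mem_span hX hf (hπ _)
  choose e he hle using h
  refine ⟨∑ j, e j, Submodule.sum_mem _ fun j _ => he j, fun g => ?_⟩
  have hsum : (r g).mulVec (∑ j, e j) = ∑ j, (r g).mulVec (e j) :=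
    map_sum (Matrix.mulVecLin (r g)) _ _
  have h0 : 0 ≤ ∑ j, f ((r g).mulVec (e j)) :=
    Finset.sum_nonneg fun j _ => (norm_nonneg _).trans (hle j g)
  rw [hsum, map_sum, Matrix.linfty_opNorm_eq_opNorm]
  refine ContinuousLinearMap.opNorm_le_bound _ h0 fun u => ?_
  have hu : (r g * π).mulVec u = ∑ j, u j • (r g).mulVec (π.mulVec (Pi.single j 1)) := by
    conv_lhs => rw [pi_eq_sum_univ' u]
    rw [← Matrix.mulVecLin_apply, map_sum]
    refine Finset.sum_congr rfl fun j _ => ?_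
    rw [map_smul, Matrix.mulVecLin_apply, Matrix.mulVec_mulVec]
  change ‖(r g * π).mulVec u‖ ≤ _
  rw [hu, Finset.sum_mul]
  refine (norm_sum_le _ _).trans (Finset.sum_le_sum fun j _ => ?_)
  rw [norm_smul, mul_comm]
  exact mul_le_mul (hle j g) (norm_le_pi_norm u j) (norm_nonneg _) ((norm_nonneg _).trans (hle j g))

/-- The span of a dominated set can be enlarged as long as it is not the whole space. -/
theorem IsDominated.exists_span_lt {r : G →* Matrix ι ι ℝ} (hr : IsReductive (Set.range r))
    (hs : ∀ x ∈ imageCone r, -x ∈ imageCone r → x = 0) {X : Set (ι → ℝ)} (hX : IsDominated r X)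
    (htop : Submodule.span ℝ X ≠ ⊤) :
    ∃ X', IsDominated r X' ∧ Submodule.span ℝ X < Submodule.span ℝ X' := by
  obtain ⟨hXr, f, hf⟩ := hX
  obtain ⟨π, hπ, hπW, hcomm'⟩ := hr.adjoin (Submodule.span ℝ X) (by
    intro a ha w hw
    refine Algebra.adjoin_induction (p := fun a _ => ∀ w ∈ Submodule.span ℝ X,
      a.mulVec w ∈ Submodule.span ℝ X) ?_ ?_ ?_ ?_ ha w hw
    · rintro _ ⟨g, rfl⟩ w hw
      have : (Submodule.span ℝ X) ≤ (Submodule.span ℝ X).comap (Matrix.mulVecLin (r g)) :=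
        Submodule.span_le.2 fun x hx => Submodule.subset_span (hXr g x hx)
      exact this hw
    · intro c w hw
      rw [Algebra.algebraMap_eq_smul_one, Matrix.smul_mulVec, Matrix.one_mulVec]
      exact Submodule.smul_mem _ _ hw
    · intro x y _ _ hx hy w hw
      rw [Matrix.add_mulVec]; exact add_mem (hx w hw) (hy w hw)
    · intro x y _ _ hx hy w hw
      rw [← Matrix.mulVec_mulVec]; exact hx _ (hy w hw))
  have hcomm : ∀ p ∈ imageCone r, π * p = p * π := fun p hp => hcomm' p (imageCone_le_adjoin hp)
  have hcr : ∀ g, π * r g = r g * π := fun g => hcomm _ (apply_mem_imageCone r g)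
  have hπX : ∀ x ∈ X, π.mulVec x = x := fun x hx => hπW x (Submodule.subset_span hx)
  let Pr : (ι → ℝ) →L[ℝ] (ι → ℝ) := LinearMap.toContinuousLinearMap (Matrix.mulVecLin π)
  have hPr : ∀ v, Pr v = π.mulVec v := fun v => rfl
  by_cases hJ : ∃ p ∈ imageCone r, p * π = 0 ∧ p ≠ 0
  -- Some non-zero element of the cone kills the span of `X`. One of minimal rank is chosen, so that
  -- its orbit at a vector `v` can be dominated.
  · have hrank : ∃ k, ∃ p ∈ imageCone r, p * π = 0 ∧ p ≠ 0 ∧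
        Module.finrank ℝ (LinearMap.range (Matrix.mulVecLin p)) = k := by
      obtain ⟨p, h1, h2, h3⟩ := hJ
      exact ⟨_, p, h1, h2, h3, rfl⟩
    classical
    obtain ⟨p, hp, hpπ, hp0, hpk⟩ := Nat.find_spec hrank
    have hmin : ∀ q ∈ imageCone r, q * π = 0 → q ≠ 0 →
        Module.finrank ℝ (LinearMap.range (Matrix.mulVecLin p)) ≤
          Module.finrank ℝ (LinearMap.range (Matrix.mulVecLin q)) := fun q h1 h2 h3 =>
      hpk ▸ Nat.find_min' hrank ⟨q, h1, h2, h3, rfl⟩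
    obtain ⟨v, hv⟩ : ∃ v, p.mulVec v ≠ 0 := by
      by_contra! h
      exact hp0 (Matrix.toLin'.injective (LinearMap.ext fun v => by simpa using h v))
    let Q : PointedCone ℝ (Matrix ι ι ℝ) :=
      { carrier := {q | q ∈ imageCone r ∧ ∀ u, p.mulVec u = 0 → q.mulVec u = 0}
        add_mem' := fun {a b} ha hb => ⟨add_mem ha.1 hb.1, fun u hu => by
          rw [Matrix.add_mulVec, ha.2 u hu, hb.2 u hu, add_zero]⟩
        zero_mem' := ⟨zero_mem _, fun u _ => Matrix.zero_mulVec u⟩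
        smul_mem' := fun c a ha => ⟨Submodule.smul_mem _ c ha.1, fun u hu => by
          change ((c : ℝ) • a).mulVec u = 0
          rw [Matrix.smul_mulVec, ha.2 u hu, smul_zero]⟩ }
    have hQ : IsClosed (Q : Set (Matrix ι ι ℝ)) := by
      have : (Q : Set (Matrix ι ι ℝ)) = (imageCone r : Set (Matrix ι ι ℝ)) ∩
          ⋂ u, ⋂ _ : p.mulVec u = 0, {q | q.mulVec u = 0} := by
        ext q; simp [Q]
      rw [this]
      exact (isClosed_imageCone r).inter (isClosed_iInter fun u => isClosed_iInter fun _ =>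
        isClosed_eq (by fun_prop) continuous_const)
    let T : Matrix ι ι ℝ →L[ℝ] (ι → ℝ) := LinearMap.toContinuousLinearMap
      ((LinearMap.applyₗ v).comp (Matrix.toLin' (R := ℝ) (m := ι) (n := ι)).toLinearMap)
    have hT : ∀ q, T q = q.mulVec v := fun q => by simp [T, Matrix.toLin'_apply]
    -- An element of `Q` kills `ker p`; if it is non-zero, minimality of the rank forces its kernel
    -- to be exactly `ker p`, which does not contain `v`.
    have hQT : ∀ q ∈ Q, T q = 0 → q = 0 := by
      intro q hq hq0
      by_contra hne
      rw [hT] at hq0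
      have hqπ : q * π = 0 := by
        refine Matrix.toLin'.injective (LinearMap.ext fun u => ?_)
        rw [Matrix.toLin'_apply, ← Matrix.mulVec_mulVec, map_zero, LinearMap.zero_apply]
        exact hq.2 _ (by rw [Matrix.mulVec_mulVec, hpπ, Matrix.zero_mulVec])
      have h1 := hmin q hq.1 hqπ hne
      have hker : LinearMap.ker (Matrix.mulVecLin p) ≤ LinearMap.ker (Matrix.mulVecLin q) :=
        fun u hu => hq.2 u hu
      have h2 := LinearMap.finrank_range_add_finrank_ker (Matrix.mulVecLin p)
      have h3 := LinearMap.finrank_range_add_finrank_ker (Matrix.mulVecLin q)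
      have h4 := Submodule.eq_of_le_of_finrank_le hker (by omega)
      have h5 : v ∈ LinearMap.ker (Matrix.mulVecLin q) := hq0
      rw [← h4] at h5
      exact hv h5
    obtain ⟨f', hf'⟩ := exists_norm_map_le_of_salient Q hQ
      (fun x hx hnx => hs x hx.1 hnx.1) T hQT
    have hgp : ∀ g, r g * p ∈ Q := fun g =>
      ⟨mul_mem_imageCone (apply_mem_imageCone r g) hp, fun u hu => by
        rw [← Matrix.mulVec_mulVec, hu, Matrix.mulVec_zero]⟩
    have hπgp : ∀ g, π.mulVec ((r g * p).mulVec v) = 0 := by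
      intro g
      rw [Matrix.mulVec_mulVec, hcomm _ (hgp g).1, mul_assoc, hpπ, mul_zero, Matrix.zero_mulVec]
    refine ⟨X ∪ Set.range fun g => (r g * p).mulVec v, ⟨?_, ?_⟩, ?_⟩
    · rintro g x (hx | ⟨g', rfl⟩)
      · exact Or.inl (hXr g x hx)
      · refine Or.inr ⟨g * g', ?_⟩
        simp only [map_mul, Matrix.mulVec_mulVec, mul_assoc]
    -- The old vectors lie in the image of `π` and the new ones in its kernel, so each functional
    -- acts only on its own part.
    · refine ⟨f.comp Pr + f'.comp (ContinuousLinearMap.id ℝ _ - Pr), ?_⟩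
      rintro x (hx | ⟨g, rfl⟩)
      · simpa [hPr, hπX x hx] using hf x hx
      · have : ‖(r g * p).mulVec v‖ ≤ f' ((r g * p).mulVec v) := hf' _ (hgp g)
        simpa [hPr, hπgp g] using this
    · refine lt_of_le_of_ne (Submodule.span_mono Set.subset_union_left) fun heq => hv ?_
      have hmem : (r 1 * p).mulVec v ∈ Submodule.span ℝ X := by
        rw [heq]; exact Submodule.subset_span (Or.inr ⟨1, rfl⟩)
      rw [map_one, one_mul] at hmem
      have := hπgp 1
      rw [map_one, one_mul] at this
      rw [← hπW _ hmem, this]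
  · push Not at hJ
    -- No non-zero element of the cone kills the span of `X`, so by compactness the norm of a cone
    -- element is controlled by its restriction to that span.
    obtain ⟨c, hc0, hc⟩ : ∃ c, 0 ≤ c ∧ ∀ p ∈ imageCone r, ‖p‖ ≤ c * ‖p * π‖ := by
      have hcpt : IsCompact ((imageCone r : Set (Matrix ι ι ℝ)) ∩ Metric.sphere 0 1) :=
        (isCompact_sphere 0 1).inter_left (isClosed_imageCone r)
      obtain ⟨c, hc, hcp⟩ : ∃ c > 0, ∀ p ∈ (imageCone r : Set (Matrix ι ι ℝ)) ∩
          Metric.sphere 0 1, c ≤ ‖p * π‖ := by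
        rcases ((imageCone r : Set (Matrix ι ι ℝ)) ∩ Metric.sphere 0 1).eq_empty_or_nonempty
          with h | h
        · exact ⟨1, one_pos, by simp [h]⟩
        · obtain ⟨x, hx, hmin⟩ := hcpt.exists_isMinOn h
            (f := fun p => ‖p * π‖) (by fun_prop)
          refine ⟨‖x * π‖, norm_pos_iff.2 fun h0 => ?_, fun y hy => hmin hy⟩
          have := hx.2
          simp [hJ x hx.1 h0] at this
      refine ⟨c⁻¹, by positivity, fun p hp => ?_⟩
      rcases eq_or_ne p 0 with rfl | hp0
      · simp
      have hn : 0 < ‖p‖ := norm_pos_iff.2 hp0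
      have := hcp (‖p‖⁻¹ • p) ⟨PointedCone.smul_mem _ (inv_nonneg.2 hn.le) hp, by
        simp [norm_smul, hn.ne']⟩
      rw [smul_mul_assoc, norm_smul, norm_inv, norm_norm, inv_mul_eq_div, le_div_iff₀ hn] at this
      rw [inv_mul_eq_div, le_div_iff₀ hc]
      linarith
    obtain ⟨e, he, hle⟩ := exists_norm_mul_projection_le hXr hf hπ
    have hfe : ∀ g, 0 ≤ f ((r g).mulVec e) := fun g => (norm_nonneg _).trans (hle g)
    have hree : ∀ g, ‖(r g).mulVec e‖ ≤ ‖e‖ * f ((r g).mulVec e) := by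
      intro g
      conv_lhs => rw [← hπW e he]
      rw [Matrix.mulVec_mulVec, mul_comm]
      exact (Matrix.linfty_opNorm_mulVec _ _).trans (by gcongr; exact hle g)
    -- The vector `e` lies in the span and its orbit dominates `‖r g * π‖`, hence also `‖r g‖`.
    -- Adding a bounded vector of `ker π` therefore keeps the orbit dominated, and these vectors
    -- fill the complement.
    refine ⟨X ∪ {x | ∃ g w, π.mulVec w = 0 ∧ ‖w‖ ≤ 1 ∧ x = (r g).mulVec (e + w)}, ⟨?_, ?_⟩, ?_⟩
    · rintro g x (hx | ⟨g', w, hw, hw1, rfl⟩)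
      · exact Or.inl (hXr g x hx)
      · exact Or.inr ⟨g * g', w, hw, hw1, by rw [map_mul, Matrix.mulVec_mulVec]⟩
    -- The terms `‖e‖` and `c` pay for the orbits of `e` and of `w`; the `1` keeps the bound on `X`.
    · refine ⟨(1 + ‖e‖ + c) • f.comp Pr, ?_⟩
      rintro x (hx | ⟨g, w, hw, hw1, rfl⟩)
      · have h1 := hf x hx
        have h2 : 0 ≤ f x := (norm_nonneg _).trans h1
        have h3 : ((1 + ‖e‖ + c) • f.comp Pr) x = (1 + ‖e‖ + c) * f x := by
          simp [hPr, hπX x hx]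
        rw [h3]
        nlinarith [norm_nonneg e]
      · have h3 : ((1 + ‖e‖ + c) • f.comp Pr) ((r g).mulVec (e + w)) =
            (1 + ‖e‖ + c) * f ((r g).mulVec e) := by
          have : π.mulVec ((r g).mulVec (e + w)) = (r g).mulVec e := by
            rw [Matrix.mulVec_mulVec, hcr, ← Matrix.mulVec_mulVec, Matrix.mulVec_add, hw, add_zero,
              hπW e he]
          simp [hPr, this]
        have h4 : ‖(r g).mulVec w‖ ≤ c * f ((r g).mulVec e) :=
          calc _ ≤ ‖r g‖ * ‖w‖ := Matrix.linfty_opNorm_mulVec _ _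
            _ ≤ ‖r g‖ * 1 := by gcongr
            _ = ‖r g‖ := mul_one _
            _ ≤ c * ‖r g * π‖ := hc _ (apply_mem_imageCone r g)
            _ ≤ _ := by gcongr; exact hle g
        rw [h3, Matrix.mulVec_add]
        refine (norm_add_le _ _).trans ?_
        have := hree g
        have := hfe g
        nlinarith
    · refine lt_of_le_of_ne (Submodule.span_mono Set.subset_union_left) fun heq => htop ?_
      refine Submodule.eq_top_iff'.2 fun v => ?_
      have hmemS : ∀ w, π.mulVec w = 0 → ‖w‖ ≤ 1 → w ∈ Submodule.span ℝ X := by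
        intro w hw hw1
        have : e + w ∈ Submodule.span ℝ X := by
          rw [heq]
          exact Submodule.subset_span (Or.inr ⟨1, w, hw, hw1, by simp⟩)
        exact (Submodule.add_mem_iff_right _ he).1 this
      have hππ : π.mulVec (v - π.mulVec v) = 0 := by
        rw [Matrix.mulVec_sub, hπW _ (hπ v), sub_self]
      have hmem : v - π.mulVec v ∈ Submodule.span ℝ X := by
        have hn : 0 < 1 + ‖v - π.mulVec v‖ := by positivity
        have := hmemS ((1 + ‖v - π.mulVec v‖)⁻¹ • (v - π.mulVec v))
          (by rw [Matrix.mulVec_smul, hππ, smul_zero]) (by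
            rw [norm_smul, norm_inv, Real.norm_of_nonneg hn.le, inv_mul_eq_div, div_le_one hn]
            linarith)
        exact (Submodule.smul_mem_iff _ (inv_ne_zero hn.ne')).1 this
      have := add_mem hmem (hπ v)
      rwa [sub_add_cancel] at this

/-- A matrix representation preserves a closed salient cone with non-empty interior. -/
def PreservesProperCone (r : G →* Matrix ι ι ℝ) : Prop :=
  ∃ K : PointedCone ℝ (ι → ℝ), IsClosed (K : Set (ι → ℝ)) ∧ (∀ x ∈ K, -x ∈ K → x = 0) ∧
    (interior (K : Set (ι → ℝ))).Nonempty ∧ ∀ g, ∀ x ∈ K, (r g).mulVec x ∈ K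

theorem IsDominated.preservesProperCone {r : G →* Matrix ι ι ℝ} {X : Set (ι → ℝ)}
    (hX : IsDominated r X) (htop : Submodule.span ℝ X = ⊤) : PreservesProperCone r := by
  obtain ⟨hXr, f, hf⟩ := hX
  let C : PointedCone ℝ (ι → ℝ) := PointedCone.hull ℝ X
  have hK : ((C.closure : PointedCone ℝ (ι → ℝ)) : Set (ι → ℝ)) = closure (C : Set (ι → ℝ)) :=
    PointedCone.coe_closure C
  have hle : ∀ (D : PointedCone ℝ (ι → ℝ)), IsClosed (D : Set (ι → ℝ)) → X ⊆ D →
      ∀ x ∈ C.closure, x ∈ D := by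
    intro D hD hXD x hx
    rw [PointedCone.mem_closure] at hx
    exact closure_minimal (Submodule.span_le.2 hXD) hD hx
  have hXC : X ⊆ (C.closure : Set (ι → ℝ)) := by
    rw [hK]; exact PointedCone.subset_hull.trans subset_closure
  have hcl : IsClosed (C.closure : Set (ι → ℝ)) := by rw [hK]; exact isClosed_closure
  let D : PointedCone ℝ (ι → ℝ) :=
    { carrier := {x | ‖x‖ ≤ f x}
      add_mem' := fun {x y} hx hy => by
        rw [Set.mem_ofPred_eq, map_add]
        exact (norm_add_le _ _).trans (add_le_add hx hy)
      zero_mem' := by simp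
      smul_mem' := fun c x hx => by
        change ‖(c : ℝ) • x‖ ≤ f ((c : ℝ) • x)
        rw [norm_smul, map_smul, Real.norm_of_nonneg c.2, smul_eq_mul]
        exact mul_le_mul_of_nonneg_left hx c.2 }
  have hfK : ∀ x ∈ C.closure, ‖x‖ ≤ f x :=
    hle D (isClosed_le continuous_norm f.continuous) hf
  refine ⟨C.closure, hcl, fun x hx hnx => ?_, ?_, fun g => ?_⟩
  · have h1 := hfK x hx
    have h2 := hfK _ hnx
    rw [norm_neg, map_neg] at h2
    exact norm_le_zero_iff.1 (by linarith)
  · have hne : (interior (C : Set (ι → ℝ))).Nonempty := by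
      rw [C.convex.interior_nonempty_iff_affineSpan_eq_top,
        ← AffineSubspace.direction_eq_top_iff_of_nonempty ⟨0, subset_affineSpan ℝ _ C.zero_mem⟩,
        direction_affineSpan, eq_top_iff, ← htop, Submodule.span_le]
      intro x hx
      have := vsub_mem_vectorSpan ℝ (PointedCone.subset_hull hx : x ∈ (C : Set (ι → ℝ)))
        C.zero_mem
      simpa using this
    exact hne.mono (interior_mono (by rw [hK]; exact subset_closure))
  · exact hle (C.closure.comap (Matrix.mulVecLin (r g)))
      (hcl.preimage (f := fun x => (r g).mulVec x) (by fun_prop)) fun x hx => hXC (hXr g x hx)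

/-- Among dominated sets, starting from the empty one, a set of maximal span must span everything;
its closed conical hull is the desired cone. -/
theorem preservesProperCone_of_isReductive {r : G →* Matrix ι ι ℝ}
    (hr : IsReductive (Set.range r))
    (hPF : ∀ A ∈ PointedCone.hull ℝ (Set.range r),
      |(A * A).trace| ≤ Fintype.card ι * ‖A + A * A‖) : PreservesProperCone r := by
  have hPF' : ∀ A ∈ imageCone r, |(A * A).trace| ≤ Fintype.card ι * ‖A + A * A‖ := by
    intro A hA
    rw [imageCone, PointedCone.mem_closure] at hA
    exact closure_minimal (t := {A : Matrix ι ι ℝ | |(A * A).trace| ≤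
      Fintype.card ι * ‖A + A * A‖}) hPF (isClosed_le (by fun_prop) (by fun_prop)) hA
  have hs : ∀ x ∈ imageCone r, -x ∈ imageCone r → x = 0 := fun x hx hnx =>
    imageCone_salient hr hPF' hx hnx
  obtain ⟨W, ⟨X, hX, rfl⟩, hmax⟩ := (wellFounded_gt (α := Submodule ℝ (ι → ℝ))).has_min
    {W | ∃ X, IsDominated r X ∧ Submodule.span ℝ X = W} ⟨_, ∅, ⟨by simp, 0, by simp⟩, rfl⟩
  refine hX.preservesProperCone ?_
  by_contra htop
  obtain ⟨X', hX', hlt⟩ := hX.exists_span_lt hr hs htop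
  exact hmax _ ⟨X', hX', rfl⟩ hlt

end ConvexProjective

end

/-! ### Bounded traces, conjugation and invariant functions. -/

noncomputable section

namespace ConvexProjective

open scoped Matrix.Norms.Operator

open Filter Topology

section Bounded

variable {ι : Type*} [Fintype ι] [DecidableEq ι]

/-- Families of matrices whose words have bounded trace are bounded if they have almost minimal norm
in their conjugacy class. -/
theorem exists_eventually_norm_le_of_trace_bounded {σ L : Type*} [Fintype σ] (l : Ultrafilter L)
    (R : L → σ → Matrix ι ι ℝ)
    (htr : ∀ w : FreeMonoid σ, ∃ C, ∀ᶠ i in (l : Filter L), |(FreeMonoid.lift (R i) w).trace| ≤ C)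
    (hmin : ∀ i, ∀ h : (Matrix ι ι ℝ)ˣ, ‖R i‖ ≤ ‖fun s => h.1 * R i s * (h⁻¹).1‖ + 1) :
    ∃ C, ∀ᶠ i in (l : Filter L), ‖R i‖ ≤ C := by
  by_contra! hbad
  -- Along an ultrafilter, failing to be eventually bounded means eventually exceeding every bound.
  have hlarge : ∀ C, ∀ᶠ i in (l : Filter L), C < ‖R i‖ := hbad
  have htop : Tendsto (fun i => ‖R i‖) l atTop :=
    tendsto_atTop.2 fun C => (hlarge C).mono fun i hi => hi.le
  let B : L → σ → Matrix ι ι ℝ := fun i => ‖R i‖⁻¹ • R i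
  obtain ⟨B₀, -, hB₀⟩ := isCompact_iff_ultrafilter_le_nhds.1
    (isCompact_closedBall (0 : σ → Matrix ι ι ℝ) 1) (l.map B) (by
      rw [le_principal_iff]
      refine Eventually.of_forall (f := (l : Filter L)) fun i => ?_
      rw [mem_closedBall_zero_iff, norm_smul, norm_inv, norm_norm]
      exact inv_mul_le_one)
  have hB : Tendsto B l (𝓝 B₀) := hB₀
  have hBs : ∀ s, Tendsto (fun i => B i s) l (𝓝 (B₀ s)) := tendsto_pi_nhds.1 hB
  have hlift : ∀ w : FreeMonoid σ, ∀ i,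
      FreeMonoid.lift (B i) w = (‖R i‖⁻¹) ^ w.length • FreeMonoid.lift (R i) w := by
    intro w i
    induction w using FreeMonoid.inductionOn' with
    | one => simp
    | of_mul a w ih =>
      rw [map_mul, map_mul, ih, FreeMonoid.lift_eval_of, FreeMonoid.lift_eval_of,
        FreeMonoid.length_mul, FreeMonoid.length_of]
      simp only [B, Pi.smul_apply]
      rw [smul_mul_smul_comm, pow_add, pow_one]
  have hlim : ∀ w : FreeMonoid σ, Tendsto (fun i => FreeMonoid.lift (B i) w) l
      (𝓝 (FreeMonoid.lift B₀ w)) := by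
    intro w
    induction w using FreeMonoid.inductionOn' with
    | one => simp
    | of_mul a w ih =>
      simp only [map_mul, FreeMonoid.lift_eval_of]
      exact (hBs a).mul ih
  -- Only non-empty words are considered: for these the rescaling factor is a positive power of `‖R
  -- i‖⁻¹`, which kills the bounded traces in the limit.
  have hzero : ∀ (s : σ) (w : FreeMonoid σ), (B₀ s * FreeMonoid.lift B₀ w).trace = 0 := by
    intro s w
    have hw : B₀ s * FreeMonoid.lift B₀ w = FreeMonoid.lift B₀ (FreeMonoid.of s * w) := by
      rw [map_mul, FreeMonoid.lift_eval_of]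
    rw [hw]
    obtain ⟨C, hC⟩ := htr (FreeMonoid.of s * w)
    have h1 : Tendsto (fun i => (FreeMonoid.lift (B i) (FreeMonoid.of s * w)).trace) l
        (𝓝 (FreeMonoid.lift B₀ (FreeMonoid.of s * w)).trace) := by
      have hc : Continuous fun X : Matrix ι ι ℝ => X.trace := by fun_prop
      exact (hc.tendsto _).comp (hlim _)
    refine tendsto_nhds_unique h1 ?_
    have hinv : Tendsto (fun i => (‖R i‖⁻¹) ^ (FreeMonoid.of s * w).length * C) l (𝓝 0) := by
      have h2 : (FreeMonoid.of s * w).length ≠ 0 := by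
        rw [FreeMonoid.length_mul, FreeMonoid.length_of]; omega
      have := ((tendsto_inv_atTop_zero.comp htop).pow (FreeMonoid.of s * w).length).mul_const C
      simpa [h2] using this
    refine squeeze_zero_norm' ?_ hinv
    filter_upwards [hC] with i hi
    rw [hlift, Matrix.trace_smul, norm_smul, Real.norm_eq_abs, Real.norm_eq_abs,
      abs_of_nonneg (by positivity)]
    gcongr
  obtain ⟨h, hh⟩ := exists_conj_norm_lt_of_trace_eq_zero B₀ hzero (δ := 1 / 2) (by norm_num)
  have hev : ∀ᶠ i in (l : Filter L), ∀ s, ‖h.1 * B i s * (h⁻¹).1‖ < 1 / 2 := by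
    rw [eventually_all]
    intro s
    have : Tendsto (fun i => ‖h.1 * B i s * (h⁻¹).1‖) l (𝓝 ‖h.1 * B₀ s * (h⁻¹).1‖) :=
      (((hBs s).const_mul _).mul_const _).norm
    exact this.eventually_lt_const (hh s)
  -- Conjugation by `h` halves the norm, so almost minimality gives `‖R i‖ ≤ ‖R i‖ / 2 + 1`,
  -- impossible beyond `2`.
  obtain ⟨i, hi, hi2⟩ := (hev.and (hlarge 2)).exists
  have h1 : ‖fun s => h.1 * R i s * (h⁻¹).1‖ ≤ ‖R i‖ * (1 / 2) := by
    refine (pi_norm_le_iff_of_nonneg (by positivity)).2 fun s => ?_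
    have hR : R i s = ‖R i‖ • B i s := by
      simp only [B, Pi.smul_apply]
      rw [smul_smul, mul_inv_cancel₀ (by linarith), one_smul]
    rw [hR, mul_smul_comm, smul_mul_assoc, norm_smul, norm_norm]
    gcongr
    exact (hi s).le
  have := hmin i h
  linarith

end Bounded

section Conj

variable {ι : Type*} [Fintype ι] [DecidableEq ι] {G : Type*} [Group G]

/-- The conjugate of a matrix representation. -/
def conjHom (h : (Matrix ι ι ℝ)ˣ) (r : G →* Matrix ι ι ℝ) : G →* Matrix ι ι ℝ where
  toFun g := h.1 * r g * (h⁻¹).1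
  map_one' := by simp
  map_mul' g g' := by simp only [map_mul, mul_assoc, Units.inv_mul_cancel_left]

theorem conjHom_apply (h : (Matrix ι ι ℝ)ˣ) (r : G →* Matrix ι ι ℝ) (g : G) :
    conjHom h r g = h.1 * r g * (h⁻¹).1 := rfl

theorem conjHom_conjHom (h h' : (Matrix ι ι ℝ)ˣ) (r : G →* Matrix ι ι ℝ) :
    conjHom h (conjHom h' r) = conjHom (h * h') r := by
  ext1 g; simp only [conjHom_apply, Units.val_mul, mul_inv_rev, mul_assoc]

theorem conjHom_one (r : G →* Matrix ι ι ℝ) : conjHom 1 r = r := by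
  ext1 g; simp [conjHom_apply]

theorem det_conjHom (h : (Matrix ι ι ℝ)ˣ) (r : G →* Matrix ι ι ℝ) (g : G) :
    (conjHom h r g).det = (r g).det := by
  rw [conjHom_apply]; exact Matrix.det_units_conj h (r g)

theorem PreservesProperCone.conjHom {r : G →* Matrix ι ι ℝ} (hr : PreservesProperCone r)
    (h : (Matrix ι ι ℝ)ˣ) : PreservesProperCone (conjHom h r) := by
  obtain ⟨K, hK, hs, ⟨e, he⟩, hinv⟩ := hr
  have hcont : ∀ a : Matrix ι ι ℝ, Continuous fun v : ι → ℝ => a.mulVec v := fun a => by fun_prop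
  refine ⟨K.comap (Matrix.mulVecLin (h⁻¹).1), hK.preimage (hcont _), fun x hx hnx => ?_,
    ⟨h.1.mulVec e, ?_⟩, fun g x hx => ?_⟩
  · have := hs _ hx (by rw [← map_neg]; exact hnx)
    have h0 : h.1.mulVec ((h⁻¹).1.mulVec x) = 0 := by
      rw [show (h⁻¹).1.mulVec x = 0 from this, Matrix.mulVec_zero]
    rwa [Matrix.mulVec_mulVec, Units.mul_inv, Matrix.one_mulVec] at h0
  · refine preimage_interior_subset_interior_preimage (hcont (h⁻¹).1) ?_
    rw [Set.mem_preimage, Matrix.mulVec_mulVec, Units.inv_mul, Matrix.one_mulVec]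
    exact he
  · rw [PointedCone.mem_comap, Matrix.mulVecLin_apply, conjHom_apply, Matrix.mulVec_mulVec,
      mul_assoc, Units.inv_mul_cancel_left, ← Matrix.mulVec_mulVec]
    exact hinv g _ hx

/-- The closed condition on a matrix representation that holds if it preserves a proper cone. -/
def HasPerronFrobenius (r : G →* Matrix ι ι ℝ) : Prop :=
  ∀ h : (Matrix ι ι ℝ)ˣ, ∀ A ∈ PointedCone.hull ℝ (Set.range (conjHom h r)),
    |(A * A).trace| ≤ Fintype.card ι * ‖A + A * A‖

theorem PreservesProperCone.hasPerronFrobenius {r : G →* Matrix ι ι ℝ}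
    (hr : PreservesProperCone r) : HasPerronFrobenius r := by
  intro h A hA
  obtain ⟨K, hK, hs, hi, hinv⟩ := hr.conjHom h
  refine abs_trace_sq_le_of_preserves_cone K hK hs hi A ?_
  induction hA using Submodule.span_induction with
  | mem x hx => obtain ⟨g, rfl⟩ := hx; exact hinv g
  | zero => intro x _; rw [Matrix.zero_mulVec]; exact zero_mem _
  | add a b _ _ ha hb =>
    intro x hx; rw [Matrix.add_mulVec]; exact add_mem (ha x hx) (hb x hx)
  | smul c a _ ha =>
    intro x hx
    change ((c : ℝ) • a).mulVec x ∈ K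
    rw [Matrix.smul_mulVec]
    exact K.smul_mem c.2 (ha x hx)

/-- An element of the hull is a finite combination of values of the representation, so keeping its
coefficients exhibits it as a limit of hull elements. This is why the condition uses the hull and
not its closure. -/
theorem HasPerronFrobenius.of_tendsto {L : Type*} {l : Filter L} [l.NeBot]
    {r : L → G →* Matrix ι ι ℝ} {r₀ : G →* Matrix ι ι ℝ}
    (hr : ∀ g, Tendsto (fun i => r i g) l (𝓝 (r₀ g))) (h : ∀ i, HasPerronFrobenius (r i)) :
    HasPerronFrobenius r₀ := by
  intro u A hA
  obtain ⟨c, rfl⟩ := Finsupp.mem_span_range_iff_exists_finsupp.1 hA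
  let A' : L → Matrix ι ι ℝ := fun i => c.sum fun g a => a • conjHom u (r i) g
  have hA' : Tendsto A' l (𝓝 (c.sum fun g a => a • conjHom u r₀ g)) := by
    refine tendsto_finsetSum _ fun g _ => ?_
    change Tendsto (fun i => ((c g : ℝ)) • (u.1 * r i g * (u⁻¹).1)) l
      (𝓝 ((c g : ℝ) • (u.1 * r₀ g * (u⁻¹).1)))
    exact (((hr g).const_mul _).mul_const _).const_smul _
  have hc1 : Continuous fun X : Matrix ι ι ℝ => |(X * X).trace| := by fun_prop
  have hc2 : Continuous fun X : Matrix ι ι ℝ => Fintype.card ι * ‖X + X * X‖ := by fun_prop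
  exact le_of_tendsto_of_tendsto ((hc1.tendsto _).comp hA') ((hc2.tendsto _).comp hA')
    (Eventually.of_forall fun i => h i u _ (Finsupp.mem_span_range_iff_exists_finsupp.2 ⟨c, rfl⟩))

theorem HasPerronFrobenius.conjHom {r : G →* Matrix ι ι ℝ} (hr : HasPerronFrobenius r)
    (h : (Matrix ι ι ℝ)ˣ) : HasPerronFrobenius (conjHom h r) := fun h' => by
  rw [conjHom_conjHom]; exact hr (h' * h)

/-- The values of a representation are bounded in terms of bounds on generators. -/
theorem exists_norm_apply_le {S : Set G} (hS : Submonoid.closure S = ⊤) (C : ℝ) (g : G) :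
    ∃ C', ∀ r : G →* Matrix ι ι ℝ, (∀ s ∈ S, ‖r s‖ ≤ C) → ‖r g‖ ≤ C' := by
  have hg : g ∈ Submonoid.closure S := hS ▸ Submonoid.mem_top g
  induction hg using Submonoid.closure_induction with
  | mem x hx => exact ⟨C, fun r hr => hr x hx⟩
  | one => exact ⟨‖(1 : Matrix ι ι ℝ)‖, fun r _ => by rw [map_one]⟩
  | mul x y _ _ hx hy =>
    obtain ⟨a, ha⟩ := hx
    obtain ⟨b, hb⟩ := hy
    refine ⟨a * b, fun r hr => ?_⟩
    rw [map_mul]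
    exact (norm_mul_le _ _).trans (mul_le_mul (ha r hr) (hb r hr) (norm_nonneg _)
      ((norm_nonneg _).trans (ha r hr)))

end Conj

section Invariants

variable {n : ℕ} {G : Type*} [Group G]

/-- The projective representation defined by a matrix representation. -/
def projRep (r : G →* Matrix (Fin (n + 1)) (Fin (n + 1)) ℝ) : Rep G n :=
  (Matrix.ProjGenLinGroup.mk (n := Fin (n + 1)) (R := ℝ)).comp r.toHomUnits

theorem projRep_apply (r : G →* Matrix (Fin (n + 1)) (Fin (n + 1)) ℝ) (g : G) :
    projRep r g = Matrix.ProjGenLinGroup.mk (r.toHomUnits g) := rfl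

theorem projRep_conjHom (h : (Matrix (Fin (n + 1)) (Fin (n + 1)) ℝ)ˣ)
    (r : G →* Matrix (Fin (n + 1)) (Fin (n + 1)) ℝ) :
    projRep (conjHom h r) = conjRep (Matrix.ProjGenLinGroup.mk h) (projRep r) := by
  ext1 g
  have : (conjHom h r).toHomUnits g = h * r.toHomUnits g * h⁻¹ := Units.ext rfl
  rw [projRep_apply, this, map_mul, map_mul, map_inv]
  rfl

theorem chi_conjHom (h : (Matrix (Fin (n + 1)) (Fin (n + 1)) ℝ)ˣ)
    (r : G →* Matrix (Fin (n + 1)) (Fin (n + 1)) ℝ) :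
    chi G n (projRep (conjHom h r)) = chi G n (projRep r) := by
  refine AlgHom.ext fun F => ?_
  change F.1 (projRep (conjHom h r)) = F.1 (projRep r)
  rw [projRep_conjHom]
  exact F.2.2 _ _

/-- The regular functions on the representation variety are continuous. -/
theorem tendsto_of_mem_coordinateRing {F : Rep G n → ℝ} (hF : F ∈ coordinateRing G n) {L : Type*}
    {l : Filter L} {r : L → G →* Matrix (Fin (n + 1)) (Fin (n + 1)) ℝ}
    {r₀ : G →* Matrix (Fin (n + 1)) (Fin (n + 1)) ℝ}
    (hr : ∀ g, Tendsto (fun i => r i g) l (𝓝 (r₀ g))) :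
    Tendsto (fun i => F (projRep (r i))) l (𝓝 (F (projRep r₀))) := by
  induction hF using Algebra.adjoin_induction with
  | mem F hF =>
    obtain ⟨g, f, ⟨p, k, hp⟩, rfl⟩ := hF
    simp only [projRep_apply, hp, MonoidHom.coe_toHomUnits]
    have hdet : (r₀ g).det ≠ 0 := by
      have : IsUnit (r₀ g) := (Group.isUnit g).map r₀
      exact ((Matrix.isUnit_iff_isUnit_det _).1 this).ne_zero
    refine Tendsto.div ?_ ?_ (pow_ne_zero _ hdet)
    · have hc : Continuous fun X : Matrix (Fin (n + 1)) (Fin (n + 1)) ℝ =>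
          MvPolynomial.eval (fun ij : Fin (n + 1) × Fin (n + 1) => X ij.1 ij.2) p :=
        (MvPolynomial.continuous_eval p).comp (by fun_prop)
      exact (hc.tendsto _).comp (hr g)
    · have hc : Continuous fun X : Matrix (Fin (n + 1)) (Fin (n + 1)) ℝ => X.det ^ k := by fun_prop
      exact (hc.tendsto _).comp (hr g)
  | algebraMap c => exact tendsto_const_nhds
  | add F F' _ _ h h' => exact h.add h'
  | mul F F' _ _ h h' => exact h.mul h'

/-- The algebra homomorphism given by a point of the character variety. -/
def CharacterVariety.eval (x : CharacterVariety G n) : invariantRing G n →ₐ[ℝ] ℝ := x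

theorem tendsto_eval_of_tendsto_chi {L : Type*} {l : Filter L} {ρ : L → Rep G n}
    {x : CharacterVariety G n} (h : Tendsto (fun i => chi G n (ρ i)) l (𝓝 x))
    (F : invariantRing G n) :
    Tendsto (fun i => F.1 (ρ i)) l (𝓝 (x.eval F)) := by
  have hc : Continuous fun (x : CharacterVariety G n) =>
      (fun F : invariantRing G n => x.eval F) := 
    continuous_induced_dom
  exact (((continuous_apply F).comp hc).tendsto x).comp h

/-- The regular function `tr A ^ (2 (n + 1)) / det A ^ 2` on `PGL(n+1,ℝ)`. -/
theorem exists_normalized_trace (n : ℕ) : ∃ f : PGL n → ℝ, ∀ A : GL (Fin (n + 1)) ℝ,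
    f (Matrix.ProjGenLinGroup.mk A) =
      (A : Matrix (Fin (n + 1)) (Fin (n + 1)) ℝ).trace ^ (2 * (n + 1)) /
        (A : Matrix (Fin (n + 1)) (Fin (n + 1)) ℝ).det ^ 2 := by
  choose s hs using Matrix.ProjGenLinGroup.mk_surjective (n := Fin (n + 1)) (R := ℝ)
  refine ⟨fun q => (s q).1.trace ^ (2 * (n + 1)) / (s q).1.det ^ 2, fun A => ?_⟩
  obtain ⟨u, hu⟩ := Matrix.ProjGenLinGroup.mk_eq_mk_iff.1 (hs (Matrix.ProjGenLinGroup.mk A)).symm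
  have hA : (s (Matrix.ProjGenLinGroup.mk A)).1 = (u : ℝ) • A.1 := by
    rw [← hu, Units.val_mul, Matrix.GeneralLinearGroup.coe_scalar, Matrix.scalar_apply,
      ← Matrix.smul_eq_mul_diagonal]
  simp only [hA]
  rw [Matrix.trace_smul, Matrix.det_smul, smul_eq_mul, mul_pow, mul_pow, Fintype.card_fin,
    ← pow_mul, mul_comm (n + 1) 2]
  -- Rescaling by `u` multiplies numerator and denominator by the same `u ^ (2 * (n + 1))`, which
  -- makes the quotient well defined on `PGL n`.
  exact mul_div_mul_left _ _ (pow_ne_zero _ u.ne_zero)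

theorem exists_invariant_trace (n : ℕ) (g : G) : ∃ F : invariantRing G n,
    ∀ r : G →* Matrix (Fin (n + 1)) (Fin (n + 1)) ℝ,
      F.1 (projRep r) = (r g).trace ^ (2 * (n + 1)) / (r g).det ^ 2 := by
  obtain ⟨f, hf⟩ := exists_normalized_trace n
  refine ⟨⟨fun ρ => f (ρ g), Algebra.subset_adjoin ⟨g, f, ⟨(∑ i, MvPolynomial.X (i, i)) ^
    (2 * (n + 1)), 2, fun A => ?_⟩, rfl⟩, fun h ρ => ?_⟩, fun r => ?_⟩
  · rw [hf]; simp [Matrix.trace]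
  · change f (h * ρ g * h⁻¹) = f (ρ g)
    obtain ⟨A, hA⟩ := Matrix.ProjGenLinGroup.mk_surjective (ρ g)
    obtain ⟨B, rfl⟩ := Matrix.ProjGenLinGroup.mk_surjective h
    rw [← hA, ← map_inv, ← map_mul, ← map_mul, hf, hf]
    congr 2
    · rw [Units.val_mul, Units.val_mul, Matrix.trace_mul_comm, ← mul_assoc, Units.inv_mul, one_mul]
    · exact Matrix.det_units_conj B A.1
  · change f (projRep r g) = _
    rw [projRep_apply, hf]
    rfl

theorem exists_eventually_abs_trace_le {L : Type*} {l : Filter L}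
    {r : L → G →* Matrix (Fin (n + 1)) (Fin (n + 1)) ℝ} (hdet : ∀ i g, (r i g).det ^ 2 = 1)
    {x : CharacterVariety G n} (h : Tendsto (fun i => chi G n (projRep (r i))) l (𝓝 x)) (g : G) :
    ∃ C, ∀ᶠ i in l, |(r i g).trace| ≤ C := by
  obtain ⟨F, hF⟩ := exists_invariant_trace n g
  have hlim := tendsto_eval_of_tendsto_chi h F
  simp only [hF, hdet, div_one] at hlim
  refine ⟨|x.eval F| + 1, ?_⟩
  filter_upwards [hlim.abs.eventually_lt_const (lt_add_one _)] with i hi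
  rw [abs_pow] at hi
  by_contra! hlt
  have h1 : 1 ≤ |(r i g).trace| := by
    linarith [abs_nonneg (x.eval F)]
  have h2 := le_self_pow₀ h1 (n := 2 * (n + 1)) (by omega)
  linarith

end Invariants

end ConvexProjective

end

/-! ### Limits of representations over convergent characters. -/

noncomputable section

namespace ConvexProjective

open scoped Matrix.Norms.Operator

open Filter Topology

section Limits

variable {n : ℕ} {G : Type*} [Group G]

/-- The matrix representations of determinant `±1` over a point of the character variety that
satisfy the Perron-Frobenius condition. -/
def perronFrobeniusFiber (x : CharacterVariety G n) :
    Set (G → Matrix (Fin (n + 1)) (Fin (n + 1)) ℝ) :=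
  {B | ∃ r : G →* Matrix (Fin (n + 1)) (Fin (n + 1)) ℝ, ⇑r = B ∧ (∀ g, (r g).det ^ 2 = 1) ∧
    HasPerronFrobenius r ∧ chi G n (projRep r) = x}

theorem mem_perronFrobeniusFiber_of_tendsto {L : Type*} {l : Filter L} [l.NeBot]
    {r : L → G →* Matrix (Fin (n + 1)) (Fin (n + 1)) ℝ}
    {B : G → Matrix (Fin (n + 1)) (Fin (n + 1)) ℝ} {x : CharacterVariety G n}
    (hB : Tendsto (fun i => ⇑(r i)) l (𝓝 B)) (hdet : ∀ i g, (r i g).det ^ 2 = 1)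
    (hPF : ∀ i, HasPerronFrobenius (r i))
    (hx : Tendsto (fun i => chi G n (projRep (r i))) l (𝓝 x)) : B ∈ perronFrobeniusFiber x := by
  have hBg : ∀ g, Tendsto (fun i => r i g) l (𝓝 (B g)) := tendsto_pi_nhds.1 hB
  let r₀ : G →* Matrix (Fin (n + 1)) (Fin (n + 1)) ℝ :=
    { toFun := B
      map_one' := tendsto_nhds_unique (hBg 1) (by simp)
      map_mul' := fun g g' => tendsto_nhds_unique (hBg (g * g')) (by
        simpa only [map_mul] using (hBg g).mul (hBg g')) }
  have hr₀ : ∀ g, Tendsto (fun i => r i g) l (𝓝 (r₀ g)) := hBg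
  refine ⟨r₀, rfl, fun g => ?_, HasPerronFrobenius.of_tendsto hr₀ hPF, AlgHom.ext fun F => ?_⟩
  · have hc : Continuous fun X : Matrix (Fin (n + 1)) (Fin (n + 1)) ℝ => X.det ^ 2 := by fun_prop
    refine tendsto_nhds_unique ((hc.tendsto _).comp (hr₀ g)) ?_
    simp [Function.comp_def, hdet]
  · exact tendsto_nhds_unique (tendsto_of_mem_coordinateRing F.2.1 hr₀)
      (tendsto_eval_of_tendsto_chi hx F)

theorem isClosed_perronFrobeniusFiber (x : CharacterVariety G n) :
    IsClosed (perronFrobeniusFiber x) := by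
  refine isClosed_of_closure_subset fun B hB => ?_
  have := mem_closure_iff_comap_neBot.1 hB
  choose r hr hdet hPF hx using fun i : perronFrobeniusFiber x => i.2
  refine mem_perronFrobeniusFiber_of_tendsto (l := comap Subtype.val (𝓝 B)) (r := r) ?_ hdet hPF ?_
  · simp only [hr]; exact tendsto_comap
  · simp only [hx]; exact tendsto_const_nhds

/-- Convergence of characters bounds the traces of all words in the generators. Almost minimal
conjugates are then bounded on generators, hence at each group element, and a limit exists by
Tychonoff. -/
theorem perronFrobeniusFiber_nonempty [Group.FG G] {L : Type*} (l : Filter L) [l.NeBot]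
    {r : L → G →* Matrix (Fin (n + 1)) (Fin (n + 1)) ℝ} {x : CharacterVariety G n}
    (hdet : ∀ i g, (r i g).det ^ 2 = 1) (hPF : ∀ i, HasPerronFrobenius (r i))
    (hx : Tendsto (fun i => chi G n (projRep (r i))) l (𝓝 x)) :
    (perronFrobeniusFiber x).Nonempty := by
  obtain ⟨S, hS⟩ := (Group.fg_iff_monoid_fg.1 ‹Group.FG G›).fg_top
  let u : Ultrafilter L := Ultrafilter.of l
  have hu : (u : Filter L) ≤ l := Ultrafilter.of_le l
  -- The infimum over conjugates need not be attained, hence the slack `1`.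
  have hmin : ∀ i, ∃ h : (Matrix (Fin (n + 1)) (Fin (n + 1)) ℝ)ˣ,
      ∀ h' : (Matrix (Fin (n + 1)) (Fin (n + 1)) ℝ)ˣ,
      ‖fun s : S => conjHom h (r i) s‖ ≤ ‖fun s : S => conjHom h' (r i) s‖ + 1 := by
    intro i
    have hbdd : BddBelow (Set.range fun h : (Matrix (Fin (n + 1)) (Fin (n + 1)) ℝ)ˣ =>
        ‖fun s : S => conjHom h (r i) s‖) := ⟨0, by rintro _ ⟨h, rfl⟩; exact norm_nonneg _⟩
    obtain ⟨h, hh⟩ := exists_lt_of_ciInf_lt (lt_add_one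
      (⨅ h : (Matrix (Fin (n + 1)) (Fin (n + 1)) ℝ)ˣ, ‖fun s : S => conjHom h (r i) s‖))
    exact ⟨h, fun h' => hh.le.trans (by gcongr; exact ciInf_le hbdd h')⟩
  choose h hh using hmin
  let r' : L → G →* Matrix (Fin (n + 1)) (Fin (n + 1)) ℝ := fun i => conjHom (h i) (r i)
  have hdet' : ∀ i g, (r' i g).det ^ 2 = 1 := fun i g => by rw [det_conjHom, hdet]
  have hx' : Tendsto (fun i => chi G n (projRep (r' i))) u (𝓝 x) := by
    simp only [r', chi_conjHom]; exact hx.mono_left hu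
  obtain ⟨C, hC⟩ := exists_eventually_norm_le_of_trace_bounded u (fun i (s : S) => r' i s)
    (fun w => by
      have hw : ∀ i, FreeMonoid.lift (fun s : S => r' i s) w =
          r' i (FreeMonoid.lift (fun s : S => (s : G)) w) := by
        intro i
        rw [← MonoidHom.comp_apply]
        congr 1
        exact FreeMonoid.hom_eq fun s => by simp
      simp only [hw]
      exact exists_eventually_abs_trace_le hdet' hx' _)
    (fun i h' => by
      have := hh i (h' * h i)
      rw [← conjHom_conjHom] at this
      exact this)
  choose C' hC' using exists_norm_apply_le (ι := Fin (n + 1)) hS C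
  have hcpt : IsCompact (Set.univ.pi fun g : G =>
      Metric.closedBall (0 : Matrix (Fin (n + 1)) (Fin (n + 1)) ℝ) (C' g)) :=
    isCompact_univ_pi fun g => isCompact_closedBall _ _
  obtain ⟨B, -, hB⟩ := isCompact_iff_ultrafilter_le_nhds.1 hcpt (u.map fun i => ⇑(r' i)) (by
    rw [le_principal_iff]
    change ∀ᶠ i in (u : Filter L), _
    filter_upwards [hC] with i hi g _
    rw [mem_closedBall_zero_iff]
    exact hC' g _ fun s hs => (norm_le_pi_norm (fun s : S => r' i s) ⟨s, hs⟩).trans hi)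
  exact ⟨B, mem_perronFrobeniusFiber_of_tendsto (l := (u : Filter L)) hB hdet'
    (fun i => (hPF i).conjHom (h i)) hx'⟩

/-- The fibre is closed and conjugation invariant, and the Frobenius norm on generators is proper on
it, so it contains a minimal element. Commuting with the projection extends from generators to the
group. -/
theorem exists_reductive_of_perronFrobeniusFiber_nonempty [Group.FG G] {x : CharacterVariety G n}
    (hne : (perronFrobeniusFiber x).Nonempty) :
    ∃ r : G →* Matrix (Fin (n + 1)) (Fin (n + 1)) ℝ, IsReductive (Set.range r) ∧
      HasPerronFrobenius r ∧ chi G n (projRep r) = x := by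
  obtain ⟨S, hS⟩ := (Group.fg_iff_monoid_fg.1 ‹Group.FG G›).fg_top
  obtain ⟨B, ⟨r, rfl, hdet, hPF, hx⟩, hred⟩ := exists_commuting_projections
    (perronFrobeniusFiber x) (isClosed_perronFrobeniusFiber x) hne
    (by
      rintro h _ ⟨r, rfl, hdet, hPF, hx⟩
      exact ⟨conjHom h r, rfl, fun g => by rw [det_conjHom, hdet], hPF.conjHom h,
        by rw [chi_conjHom, hx]⟩) S
    (fun R => by
      obtain ⟨C, hC⟩ := (isCompact_trace_transpose_mul_self_le (ι := Fin (n + 1))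
        R).exists_bound_of_continuousOn (f := fun X => X) continuousOn_id
      choose C' hC' using exists_norm_apply_le (ι := Fin (n + 1)) hS C
      refine ⟨_, isCompact_univ_pi fun g =>
        isCompact_closedBall (0 : Matrix (Fin (n + 1)) (Fin (n + 1)) ℝ) (C' g), ?_⟩
      rintro _ ⟨r, rfl, -⟩ hR g -
      rw [mem_closedBall_zero_iff]
      refine hC' g r fun s hs => hC _ (le_trans ?_ hR)
      exact Finset.single_le_sum (f := fun s => ((r s).transpose * r s).trace)
        (fun _ _ => trace_transpose_mul_self_nonneg _) hs)
  refine ⟨r, fun W hW => ?_, hPF, hx⟩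
  obtain ⟨π, h1, h2, h3⟩ := hred W fun g => hW _ ⟨g, rfl⟩
  refine ⟨π, h1, h2, ?_⟩
  rintro _ ⟨g, rfl⟩
  have hg : g ∈ Submonoid.closure (S : Set G) := hS ▸ Submonoid.mem_top g
  induction hg using Submonoid.closure_induction with
  | mem s hs => exact h3 s hs
  | one => rw [map_one]; exact Commute.one_right π
  | mul a b _ _ ha hb => rw [map_mul]; exact ha.mul_right hb

theorem exists_preservesProperCone_of_tendsto [Group.FG G] {L : Type*} (l : Filter L) [l.NeBot]
    {r : L → G →* Matrix (Fin (n + 1)) (Fin (n + 1)) ℝ} {x : CharacterVariety G n}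
    (hdet : ∀ i g, (r i g).det ^ 2 = 1) (hr : ∀ i, PreservesProperCone (r i))
    (hx : Tendsto (fun i => chi G n (projRep (r i))) l (𝓝 x)) :
    ∃ r₀ : G →* Matrix (Fin (n + 1)) (Fin (n + 1)) ℝ, PreservesProperCone r₀ ∧
      chi G n (projRep r₀) = x := by
  obtain ⟨r₀, hred, hPF, hx₀⟩ := exists_reductive_of_perronFrobeniusFiber_nonempty
    (perronFrobeniusFiber_nonempty l hdet (fun i => (hr i).hasPerronFrobenius) hx)
  refine ⟨r₀, preservesProperCone_of_isReductive hred ?_, hx₀⟩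
  have := hPF 1
  rwa [conjHom_one] at this

end Limits

end ConvexProjective

end

/-! ### Properly convex sets and proper cones. -/

noncomputable section

namespace ConvexProjective

open Filter Topology

section LiftedCone

variable {E : Type*} [NormedAddCommGroup E] [NormedSpace ℝ E]

theorem isOpen_setOf_segment_subset {U : Set E} (hU : IsOpen U) (u : E) :
    IsOpen {w | segment ℝ u w ⊆ U} := by
  rw [isOpen_iff_mem_nhds]
  intro w hw
  have h : ∀ᶠ w' in 𝓝 w, ∀ t ∈ Set.Icc (0 : ℝ) 1, (1 - t) • u + t • w' ∈ U := by
    refine isCompact_Icc.eventually_forall_of_forall_eventually fun t ht => ?_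
    have hc : Continuous fun z : E × ℝ => (1 - z.2) • u + z.2 • z.1 := by fun_prop
    exact hc.continuousAt.eventually_mem (hU.mem_nhds (hw (by
      rw [segment_eq_image]; exact ⟨t, ht, rfl⟩)))
  filter_upwards [h] with w' hw'
  rw [segment_eq_image]
  rintro _ ⟨t, ht, rfl⟩
  exact hw' t ht

/-- The set of all vectors over a properly convex subset of projective space. -/
structure IsProperlyConvexLift (U : Set E) : Prop where
  isOpen : IsOpen U
  zero_notMem : (0 : E) ∉ U
  smul_mem : ∀ u ∈ U, ∀ a : ℝ, a ≠ 0 → a • u ∈ U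
  exists_segment : ∀ u ∈ U, ∀ w ∈ U, ∃ a b : ℝ, a ≠ 0 ∧ b ≠ 0 ∧ segment ℝ (a • u) (b • w) ⊆ U
  no_plane : ∀ W : Submodule ℝ E, Module.finrank ℝ W = 2 → ∃ w ∈ W, w ≠ 0 ∧ w ∉ closure U

namespace IsProperlyConvexLift

variable {U : Set E}

theorem exists_notMem_closure (hU : IsProperlyConvexLift U) {u w : E}
    (h : LinearIndependent ℝ ![u, w]) : ∃ s t : ℝ, s • u + t • w ≠ 0 ∧ s • u + t • w ∉ closure U := by
  have h2 := finrank_span_eq_card h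
  rw [Matrix.range_cons_cons_empty, Fintype.card_fin] at h2
  obtain ⟨x, hx, hx0, hxU⟩ := hU.no_plane _ h2
  obtain ⟨s, t, rfl⟩ := Submodule.mem_span_pair.1 hx
  exact ⟨s, t, hx0, hxU⟩

theorem add_mem_of_segment (hU : IsProperlyConvexLift U) {u w : E} (h : segment ℝ u w ⊆ U) {s t : ℝ}
    (hs : 0 ≤ s) (ht : 0 ≤ t) (hst : s + t ≠ 0) : s • u + t • w ∈ U := by
  have h0 : 0 < s + t := lt_of_le_of_ne (by positivity) hst.symm
  have hmem : (s / (s + t)) • u + (t / (s + t)) • w ∈ U :=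
    h ⟨_, _, by positivity, by positivity, by field_simp, rfl⟩
  have := hU.smul_mem _ hmem _ hst
  rwa [smul_add, smul_smul, smul_smul, mul_div_cancel₀ _ hst, mul_div_cancel₀ _ hst] at this

theorem segment_or (hU : IsProperlyConvexLift U) {u w : E} (hu : u ∈ U) (hw : w ∈ U) :
    segment ℝ u w ⊆ U ∨ segment ℝ u (-w) ⊆ U := by
  have key : ∀ (w : E) (a b : ℝ), 0 < a * b → segment ℝ (a • u) (b • w) ⊆ U →
      segment ℝ u w ⊆ U := by
    rintro w a b hab hseg _ ⟨x, y, hx, hy, hxy, rfl⟩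
    have ha : a ≠ 0 := left_ne_zero_of_mul hab.ne'
    have hb : b ≠ 0 := right_ne_zero_of_mul hab.ne'
    have h1 : 0 < x * b ^ 2 + y * (a * b) := by
      have : 0 < b ^ 2 := by positivity
      rcases hx.eq_or_lt with rfl | hx
      · rw [zero_add] at hxy; rw [hxy]; linarith
      · have := mul_pos hx this
        have := mul_nonneg hy hab.le
        linarith
    have hmem := hU.add_mem_of_segment hseg (s := x * b ^ 2) (t := y * (a * b)) (by positivity)
      (mul_nonneg hy hab.le) h1.ne'
    -- Multiplying `x • u + y • w` by `a * b ^ 2` rewrites it in terms of `a • u` and `b • w` with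
    -- the non-negative coefficients `x * b ^ 2` and `y * (a * b)`.
    have := hU.smul_mem _ hmem ((a * b ^ 2)⁻¹) (by positivity)
    convert this using 1
    rw [smul_add, smul_smul, smul_smul, smul_smul, smul_smul]
    congr 2 <;> field_simp
  obtain ⟨a, b, ha, hb, hseg⟩ := hU.exists_segment u hu w hw
  rcases (mul_ne_zero ha hb).lt_or_gt with h | h
  · exact Or.inr (key (-w) a (-b) (by linarith [mul_neg a b]) (by rwa [neg_smul_neg]))
  · exact Or.inl (key w a b h hseg)

/-- Otherwise every non-trivial combination of `u` and `w` lies in `U`: either they are dependent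
and `0 ∈ U`, or `U` contains a punctured plane. With `segment_or`, this makes `U` split into two
sheets as seen from `u`. -/
theorem not_segment_and (hU : IsProperlyConvexLift U) {u w : E} (h1 : segment ℝ u w ⊆ U)
    (h2 : segment ℝ u (-w) ⊆ U) : False := by
  have hmem : ∀ s t : ℝ, (s ≠ 0 ∨ t ≠ 0) → s • u + t • w ∈ U := by
    have key : ∀ s t : ℝ, 0 ≤ s → (s ≠ 0 ∨ t ≠ 0) → s • u + t • w ∈ U := by
      intro s t hs hst
      rcases le_total 0 t with ht | ht
      · refine hU.add_mem_of_segment h1 hs ht fun h => ?_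
        rcases hst with h' | h' <;> apply h' <;> linarith
      · have := hU.add_mem_of_segment h2 hs (neg_nonneg.2 ht) fun h => by
          rcases hst with h' | h' <;> apply h' <;> linarith
        rwa [neg_smul_neg] at this
    intro s t hst
    rcases le_total 0 s with hs | hs
    · exact key s t hs hst
    · have := hU.smul_mem _ (key (-s) (-t) (neg_nonneg.2 hs) (by simpa using hst)) (-1) (by norm_num)
      simpa [smul_smul] using this
  have hind : LinearIndependent ℝ ![u, w] := by
    rw [LinearIndependent.pair_iff]
    intro s t hst
    by_contra hne
    refine hU.zero_notMem (hst ▸ hmem s t ?_)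
    by_contra! h
    exact hne h
  obtain ⟨s, t, h0, hst⟩ := hU.exists_notMem_closure hind
  refine hst (subset_closure (hmem s t ?_))
  by_contra! h
  simp [h.1, h.2] at h0

theorem segment_subset_of_isPreconnected (hU : IsProperlyConvexLift U) {A : Set E}
    (hA : IsPreconnected A) (hAU : A ⊆ U) {u a : E} (hu : u ∈ U) (ha : a ∈ A)
    (hua : segment ℝ u a ⊆ U) : ∀ b ∈ A, segment ℝ u b ⊆ U := by
  intro b hb
  by_contra hub
  have hopen : IsOpen {w | segment ℝ u (-w) ⊆ U} :=
    (isOpen_setOf_segment_subset hU.isOpen u).preimage continuous_neg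
  obtain ⟨c, -, hc1, hc2⟩ := hA _ _ (isOpen_setOf_segment_subset hU.isOpen u) hopen
    (fun c hc => hU.segment_or hu (hAU hc)) ⟨a, ha, hua⟩
    ⟨b, hb, (hU.segment_or hu (hAU hb)).resolve_left hub⟩
  exact hU.not_segment_and hc1 hc2

/-- The set of vectors over a properly convex set is the union of an open convex cone with closure
salient and its negative. -/
theorem exists_cone (hU : IsProperlyConvexLift U) (hne : U.Nonempty) :
    ∃ C : Set E, IsOpen C ∧ Convex ℝ C ∧ C.Nonempty ∧ C ⊆ U ∧
      (∀ a : ℝ, 0 < a → ∀ x ∈ C, a • x ∈ C) ∧ (∀ u ∈ U, u ∈ C ∨ -u ∈ C) ∧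
      (∀ u ∈ C, -u ∉ C) ∧
      ∀ A ⊆ U, IsPreconnected A → ∀ a ∈ A, a ∈ C → A ⊆ C := by
  obtain ⟨v, hv⟩ := hne
  have hright : ∀ {u w : E}, segment ℝ u w ⊆ U → w ∈ U := fun h => h (right_mem_segment ℝ _ _)
  have hconn : ∀ A ⊆ U, IsPreconnected A → ∀ a ∈ A, segment ℝ v a ⊆ U →
      A ⊆ {w | segment ℝ v w ⊆ U} := fun A hAU hA a ha hva b hb =>
    hU.segment_subset_of_isPreconnected hA hAU hv ha hva b hb
  refine ⟨{w | segment ℝ v w ⊆ U}, isOpen_setOf_segment_subset hU.isOpen v, ?_,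
    ⟨v, by simpa using hv⟩, fun w hw => hright hw, ?_, fun u hu => hU.segment_or hv hu,
    fun u hu hnu => hU.not_segment_and hu hnu, hconn⟩
  · rw [convex_iff_segment_subset]
    intro w hw w' hw'
    have hww' : segment ℝ w w' ⊆ U := by
      refine hU.segment_subset_of_isPreconnected (convex_segment v w').isPreconnected hw'
        (hright hw) (left_mem_segment ℝ v w') ?_ w' (right_mem_segment ℝ v w')
      rw [segment_symm]; exact hw
    exact hconn _ hww' (convex_segment w w').isPreconnected w (left_mem_segment ℝ w w') hw
  · intro a ha x hx
    have hray : IsPreconnected ((fun c : ℝ => c • x) '' Set.Ioi 0) :=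
      isPreconnected_Ioi.image _ (by fun_prop)
    refine hconn _ ?_ hray x ⟨1, Set.mem_Ioi.2 one_pos, one_smul ℝ x⟩ hx ⟨a, ha, rfl⟩
    rintro _ ⟨c, hc, rfl⟩
    exact hU.smul_mem x (hright hx) c (ne_of_gt hc)

/-- If `x` and `-x` lie in the closure, the open cone contains a full affine line `c + s • x`; the
scalings of this line, together with the multiples of `x`, put a whole plane in the closure of `U`.
-/
theorem closure_salient (hU : IsProperlyConvexLift U) {C : Set E} (hC : IsOpen C)
    (hconv : Convex ℝ C) (hne : C.Nonempty) (hCU : C ⊆ U)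
    (hsmul : ∀ a : ℝ, 0 < a → ∀ x ∈ C, a • x ∈ C) {x : E} (hx : x ∈ closure C)
    (hnx : -x ∈ closure C) : x = 0 := by
  by_contra hx0
  obtain ⟨c, hc⟩ := hne
  have hcl : ∀ a : ℝ, 0 < a → ∀ y ∈ closure C, a • y ∈ closure C := fun a ha y hy =>
    map_mem_closure (continuous_const_smul a) hy fun z hz => hsmul a ha z hz
  have hadd : ∀ y ∈ closure C, c + y ∈ C := by
    intro y hy
    have h1 := hconv.openSegment_interior_closure_subset_interior
      (by rwa [hC.interior_eq] : c ∈ interior C) hy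
      ⟨1 / 2, 1 / 2, by norm_num, by norm_num, by norm_num, rfl⟩
    have := hsmul 2 (by norm_num) _ (interior_subset h1)
    simpa [smul_smul] using this
  have hline : ∀ s : ℝ, c + s • x ∈ C := by
    intro s
    rcases lt_trichotomy s 0 with hs | rfl | hs
    · have := hadd _ (hcl (-s) (neg_pos.2 hs) _ hnx)
      rwa [neg_smul_neg] at this
    · simpa using hc
    · exact hadd _ (hcl s hs _ hx)
  have hind : LinearIndependent ℝ ![c, x] := by
    rw [LinearIndependent.pair_iff]
    intro s t hst
    have hs : s = 0 := by
      by_contra hs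
      refine hU.zero_notMem (hCU ?_)
      have h0 : c + (s⁻¹ * t) • x = 0 := by
        rw [← smul_zero s⁻¹, ← hst, smul_add, smul_smul, smul_smul, inv_mul_cancel₀ hs, one_smul]
      exact h0 ▸ hline _
    subst hs
    simpa [hx0] using hst
  obtain ⟨s, t, h0, hst⟩ := hU.exists_notMem_closure hind
  apply hst
  by_cases hs : s = 0
  · subst hs
    have ht : t ≠ 0 := by rintro rfl; simp at h0
    rw [zero_smul, zero_add]
    exact map_mem_closure (continuous_const_smul t) (closure_mono hCU hx)
      fun z hz => hU.smul_mem z hz t ht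
  · refine subset_closure ?_
    have := hU.smul_mem _ (hCU (hline (s⁻¹ * t))) s hs
    rwa [smul_add, smul_smul, mul_inv_cancel_left₀ hs] at this

end IsProperlyConvexLift

/-- The closure of a convex set stable under positive scalings. -/
def closureCone (C : Set E) (hconv : Convex ℝ C) (hne : C.Nonempty)
    (hsmul : ∀ a : ℝ, 0 < a → ∀ x ∈ C, a • x ∈ C) : PointedCone ℝ E :=
  have hcl : ∀ a : ℝ, 0 < a → ∀ y ∈ closure C, a • y ∈ closure C := fun a ha y hy =>
    map_mem_closure (continuous_const_smul a) hy fun z hz => hsmul a ha z hz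
  have h0 : (0 : E) ∈ closure C := by
    obtain ⟨c, hc⟩ := hne
    have hlim : Tendsto (fun t : ℝ => t • c) (𝓝[>] 0) (𝓝 0) := by
      have h : Continuous fun t : ℝ => t • c := by fun_prop
      have := h.tendsto 0
      rw [zero_smul] at this
      exact this.mono_left nhdsWithin_le_nhds
    refine mem_closure_of_tendsto hlim ?_
    filter_upwards [self_mem_nhdsWithin] with t ht using hsmul t ht c hc
  { carrier := closure C
    add_mem' := fun {x y} hx hy => by
      have := hcl 2 (by norm_num) _ (hconv.closure hx hy (by norm_num : (0 : ℝ) ≤ 1 / 2)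
        (by norm_num : (0 : ℝ) ≤ 1 / 2) (by norm_num))
      simpa [smul_smul] using this
    zero_mem' := h0
    smul_mem' := fun c x hx => by
      change (c : ℝ) • x ∈ closure C
      rcases c.2.eq_or_lt with h | h
      · rw [← h, zero_smul]; exact h0
      · exact hcl _ h x hx }

end LiftedCone

/-! ### Passage between projective space and its cone. -/

section Projective

variable {n : ℕ}

/-- The vectors that represent a point of a subset of projective space. -/
def lift (Ω : Set (RP n)) : Set (Fin (n + 1) → ℝ) :=
  {u | ∃ hu : u ≠ 0, (Projectivization.mk ℝ u hu : RP n) ∈ Ω}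

theorem continuous_mk : Continuous fun v : {v : Fin (n + 1) → ℝ // v ≠ 0} =>
    (Projectivization.mk ℝ v.1 v.2 : RP n) := continuous_coinduced_rng

theorem isOpen_lift {Ω : Set (RP n)} (hΩ : IsOpen Ω) : IsOpen (lift Ω) := by
  have h := (hΩ.preimage (continuous_mk (n := n))).trans
    (isOpen_ne (x := (0 : Fin (n + 1) → ℝ)))
  convert h using 1
  ext u
  constructor
  · rintro ⟨hu, huΩ⟩
    exact ⟨⟨u, hu⟩, huΩ, rfl⟩
  · rintro ⟨v, hv, rfl⟩
    exact ⟨v.2, hv⟩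

theorem mk_mem_closure {Ω : Set (RP n)} {u : Fin (n + 1) → ℝ} (hu : u ≠ 0)
    (h : u ∈ closure (lift Ω)) : (Projectivization.mk ℝ u hu : RP n) ∈ closure Ω := by
  have h1 : (⟨u, hu⟩ : {v : Fin (n + 1) → ℝ // v ≠ 0}) ∈
      closure (Subtype.val ⁻¹' lift Ω : Set {v : Fin (n + 1) → ℝ // v ≠ 0}) := by
    rw [closure_subtype]
    refine closure_mono ?_ h
    rintro v ⟨hv, hvΩ⟩
    exact ⟨⟨v, hv⟩, ⟨hv, hvΩ⟩, rfl⟩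
  refine map_mem_closure (continuous_mk (n := n)) h1 ?_
  rintro ⟨v, hv⟩ ⟨_, hvΩ⟩
  exact hvΩ

theorem isProperlyConvexLift_lift {Ω : Set (RP n)} (hΩ : IsProperlyConvex Ω) :
    IsProperlyConvexLift (lift Ω) where
  isOpen := isOpen_lift hΩ.isOpen
  zero_notMem := fun ⟨h, _⟩ => h rfl
  smul_mem := by
    rintro u ⟨hu, huΩ⟩ a ha
    refine ⟨smul_ne_zero ha hu, ?_⟩
    convert huΩ using 1
    exact (Projectivization.mk_eq_mk_iff' ℝ _ _ _ _).2 ⟨a, rfl⟩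
  exists_segment := by
    rintro u ⟨hu, huΩ⟩ w ⟨hw, hwΩ⟩
    obtain ⟨v', w', hv', hw', h1, h2, hseg⟩ := hΩ.convex _ huΩ _ hwΩ
    obtain ⟨a, rfl⟩ := (Projectivization.mk_eq_mk_iff' ℝ _ _ _ _).1 h1
    obtain ⟨b, rfl⟩ := (Projectivization.mk_eq_mk_iff' ℝ _ _ _ _).1 h2
    exact ⟨a, b, fun h => hv' (by rw [h, zero_smul]), fun h => hw' (by rw [h, zero_smul]), hseg⟩
  no_plane := by
    intro W hW
    by_contra! h
    refine hΩ.no_line _ ⟨W, hW, rfl⟩ fun x hx => ?_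
    induction x using Projectivization.ind with
    | h v hv =>
      rw [Set.mem_ofPred_eq, Projectivization.submodule_mk, Submodule.span_singleton_le_iff_mem] at hx
      exact mk_mem_closure hv (h v hx hv)

theorem exists_det_sq_eq_one (A : GL (Fin (n + 1)) ℝ) : ∃ B : GL (Fin (n + 1)) ℝ,
    Matrix.ProjGenLinGroup.mk B = Matrix.ProjGenLinGroup.mk A ∧ B.1.det ^ 2 = 1 := by
  have hA : A.1.det ≠ 0 := ((Matrix.isUnit_iff_isUnit_det _).1 A.isUnit).ne_zero
  set c : ℝ := (|A.1.det|⁻¹) ^ (((n + 1 : ℕ) : ℝ)⁻¹) with hc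
  have hcpow : c ^ (n + 1) = |A.1.det|⁻¹ :=
    Real.rpow_inv_natCast_pow (by positivity) (Nat.succ_ne_zero n)
  have hc0 : c ≠ 0 := by
    rintro h
    rw [h, zero_pow (Nat.succ_ne_zero n)] at hcpow
    exact (inv_ne_zero (abs_ne_zero.2 hA)) hcpow.symm
  refine ⟨A * Matrix.GeneralLinearGroup.scalar _ (Units.mk0 c hc0), ?_, ?_⟩
  · rw [map_mul, Matrix.ProjGenLinGroup.mk_scalar, mul_one]
  · rw [Units.val_mul, Matrix.GeneralLinearGroup.coe_scalar, Matrix.scalar_apply,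
      ← Matrix.smul_eq_mul_diagonal, Matrix.det_smul, Fintype.card_fin, Units.val_mk0, hcpow,
      mul_pow, inv_pow, sq_abs, inv_mul_cancel₀ (pow_ne_zero _ hA)]

theorem eq_or_eq_neg_of_mk_eq {A B : GL (Fin (n + 1)) ℝ}
    (h : Matrix.ProjGenLinGroup.mk A = Matrix.ProjGenLinGroup.mk B) (hA : A.1.det ^ 2 = 1)
    (hB : B.1.det ^ 2 = 1) : B.1 = A.1 ∨ B.1 = -A.1 := by
  obtain ⟨u, rfl⟩ := Matrix.ProjGenLinGroup.mk_eq_mk_iff.1 h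
  have hval : (A * Matrix.GeneralLinearGroup.scalar _ u).1 = (u : ℝ) • A.1 := by
    rw [Units.val_mul, Matrix.GeneralLinearGroup.coe_scalar, Matrix.scalar_apply,
      ← Matrix.smul_eq_mul_diagonal]
  rw [hval, Matrix.det_smul, Fintype.card_fin, mul_pow, hA, mul_one, ← pow_mul] at hB
  rw [hval]
  have h1 : |(u : ℝ)| = 1 := by
    rw [← pow_eq_one_iff_of_nonneg (abs_nonneg _) (n := (n + 1) * 2) (by omega), ← abs_pow, hB,
      abs_one]
  rcases (abs_eq zero_le_one).1 h1 with h | h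
  · left; rw [h, one_smul]
  · right; rw [h, neg_one_smul]

variable {G : Type*} [Group G]

theorem mulVec_ne_zero (A : GL (Fin (n + 1)) ℝ) {v : Fin (n + 1) → ℝ} (hv : v ≠ 0) :
    A.1.mulVec v ≠ 0 := (smul_ne_zero_iff_ne A).2 hv

theorem mk_smul_mk (A : GL (Fin (n + 1)) ℝ) {v : Fin (n + 1) → ℝ} (hv : v ≠ 0) :
    (Matrix.ProjGenLinGroup.mk A : PGL n) • (Projectivization.mk ℝ v hv : RP n) =
      Projectivization.mk ℝ (A.1.mulVec v) (mulVec_ne_zero A hv) := rfl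

/-- A representation that preserves a properly convex set lifts to a matrix representation of
determinant `±1` that preserves a proper cone. -/
theorem exists_lift_of_mem_convexReps {ρ : Rep G n} (hρ : ρ ∈ convexReps G n) :
    ∃ r : G →* Matrix (Fin (n + 1)) (Fin (n + 1)) ℝ, PreservesProperCone r ∧
      (∀ g, (r g).det ^ 2 = 1) ∧ projRep r = ρ := by
  obtain ⟨Ω, hΩ, ⟨p, hp⟩, hinv⟩ := hρ
  have hU := isProperlyConvexLift_lift hΩ
  obtain ⟨C, hCo, hCc, ⟨c, hc⟩, hCU, hCs, hCor, hCnot, hCconn⟩ := hU.exists_cone (by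
    induction p using Projectivization.ind with
    | h v hv => exact ⟨v, hv, hp⟩)
  have hmap : ∀ g, ∃ B : GL (Fin (n + 1)) ℝ, Matrix.ProjGenLinGroup.mk B = ρ g ∧
      B.1.det ^ 2 = 1 ∧ ∀ u ∈ C, B.1.mulVec u ∈ C := by
    intro g
    have key : ∀ B : GL (Fin (n + 1)) ℝ, Matrix.ProjGenLinGroup.mk B = ρ g →
        B.1.mulVec c ∈ C → ∀ u ∈ C, B.1.mulVec u ∈ C := by
      intro B hB hBc u hu
      refine hCconn ((fun u => B.1.mulVec u) '' C) ?_ (hCc.isPreconnected.image _ (by fun_prop))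
        _ ⟨c, hc, rfl⟩ hBc ⟨u, hu, rfl⟩
      rintro _ ⟨w, hw, rfl⟩
      obtain ⟨hw0, hwΩ⟩ := hCU hw
      refine ⟨mulVec_ne_zero B hw0, ?_⟩
      rw [← mk_smul_mk B hw0, hB, ← hinv g]
      exact ⟨_, hwΩ, rfl⟩
    obtain ⟨A, hA⟩ := Matrix.ProjGenLinGroup.mk_surjective (ρ g)
    obtain ⟨B, hBA, hdet⟩ := exists_det_sq_eq_one A
    have hB := hBA.trans hA
    have hBc : B.1.mulVec c ∈ lift Ω := by
      obtain ⟨hc0, hcΩ⟩ := hCU hc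
      refine ⟨mulVec_ne_zero B hc0, ?_⟩
      rw [← mk_smul_mk B hc0, hB, ← hinv g]
      exact ⟨_, hcΩ, rfl⟩
    rcases hCor _ hBc with h | h
    · exact ⟨B, hB, hdet, key B hB h⟩
    · have hnB : Matrix.ProjGenLinGroup.mk (-B) = ρ g := by
        rw [← hB, Matrix.ProjGenLinGroup.mk_eq_mk_iff]
        refine ⟨-1, Units.ext ?_⟩
        rw [Units.val_mul, Matrix.GeneralLinearGroup.coe_scalar, Matrix.scalar_apply,
          ← Matrix.smul_eq_mul_diagonal]
        simp
      refine ⟨-B, hnB, ?_, key (-B) hnB (by rwa [Units.val_neg, Matrix.neg_mulVec])⟩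
      rw [Units.val_neg, Matrix.det_neg, mul_pow, hdet, ← pow_mul, mul_comm _ 2, pow_mul]
      simp
  -- Determinant `±1` leaves only a sign ambiguity, and preserving the sheet `C` fixes the sign.
  -- This uniqueness makes `B` multiplicative.
  choose B hB hdet hBC using hmap
  have huniq : ∀ g (A : GL (Fin (n + 1)) ℝ), Matrix.ProjGenLinGroup.mk A = ρ g →
      A.1.det ^ 2 = 1 → (∀ u ∈ C, A.1.mulVec u ∈ C) → (B g).1 = A.1 := by
    intro g A hA hAdet hAC
    rcases eq_or_eq_neg_of_mk_eq (hA.trans (hB g).symm) hAdet (hdet g) with h | h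
    · exact h
    · have := hBC g c hc
      rw [h, Matrix.neg_mulVec] at this
      exact absurd this (hCnot _ (hAC c hc))
  let r : G →* Matrix (Fin (n + 1)) (Fin (n + 1)) ℝ :=
    { toFun := fun g => (B g).1
      map_one' := huniq 1 1 (by rw [map_one, map_one]) (by simp) (by simp)
      map_mul' := fun g g' => huniq (g * g') (B g * B g') (by rw [map_mul, map_mul, hB, hB])
        (by rw [Units.val_mul, Matrix.det_mul, mul_pow, hdet, hdet, one_mul])
        (fun u hu => by
          rw [Units.val_mul, ← Matrix.mulVec_mulVec]
          exact hBC g _ (hBC g' u hu)) }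
  refine ⟨r, ⟨closureCone C hCc ⟨c, hc⟩ hCs, isClosed_closure, fun x hx hnx =>
    hU.closure_salient hCo hCc ⟨c, hc⟩ hCU hCs hx hnx, ⟨c, ?_⟩, fun g x hx => ?_⟩, hdet, ?_⟩
  · exact interior_mono subset_closure (by rwa [hCo.interior_eq])
  · exact map_mem_closure (f := fun x => (r g).mulVec x) (by fun_prop) hx fun u hu => hBC g u hu
  · ext1 g
    rw [projRep_apply, ← hB g]
    congr 1
    exact Units.ext rfl

theorem mem_interior_of_mulVec_mem {K : Set (Fin (n + 1) → ℝ)}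
    {A A' : Matrix (Fin (n + 1)) (Fin (n + 1)) ℝ} (hA : A' * A = 1)
    (hK : ∀ x, A'.mulVec x ∈ K → x ∈ K) {u : Fin (n + 1) → ℝ} (hu : u ∈ interior K) :
    A.mulVec u ∈ interior K := by
  have h : A.mulVec u ∈ interior ((fun x => A'.mulVec x) ⁻¹' K) := by
    refine preimage_interior_subset_interior_preimage (by fun_prop) ?_
    rwa [Set.mem_preimage, Matrix.mulVec_mulVec, hA, Matrix.one_mulVec]
  exact interior_mono (fun x hx => hK x hx) h

theorem zero_notMem_interior_of_salient (K : PointedCone ℝ (Fin (n + 1) → ℝ))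
    (hs : ∀ x ∈ K, -x ∈ K → x = 0) : (0 : Fin (n + 1) → ℝ) ∉ interior (K : Set (Fin (n + 1) → ℝ)) := by
  intro h
  have h1 : ∀ᶠ x in 𝓝 (0 : Fin (n + 1) → ℝ), x ∈ K := mem_interior_iff_mem_nhds.1 h
  have h2 : ∀ᶠ x in 𝓝 (0 : Fin (n + 1) → ℝ), -x ∈ K :=
    (continuous_neg.tendsto' 0 0 neg_zero).eventually h1
  obtain ⟨x, ⟨hx, hnx⟩, hx0⟩ := (((h1.and h2).filter_mono nhdsWithin_le_nhds).and
    (self_mem_nhdsWithin : {(0 : Fin (n + 1) → ℝ)}ᶜ ∈ 𝓝[≠] 0)).exists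
  exact hx0 (hs x hx hnx)

theorem isProperlyConvex_image_interior (K : PointedCone ℝ (Fin (n + 1) → ℝ))
    (hK : IsClosed (K : Set (Fin (n + 1) → ℝ))) (hs : ∀ x ∈ K, -x ∈ K → x = 0) :
    IsProperlyConvex {x : RP n | ∃ u ∈ interior (K : Set (Fin (n + 1) → ℝ)), ∃ hu : u ≠ 0,
      Projectivization.mk ℝ u hu = x} where
  isOpen := by
    rw [isOpen_coinduced]
    have h : IsOpen {v : Fin (n + 1) → ℝ | v ∈ interior (K : Set (Fin (n + 1) → ℝ)) ∨
        -v ∈ interior (K : Set (Fin (n + 1) → ℝ))} :=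
      isOpen_interior.union (isOpen_interior.preimage continuous_neg)
    convert h.preimage continuous_subtype_val using 1
    ext ⟨v, hv⟩
    simp only [Set.mem_preimage, Set.mem_ofPred_eq]
    constructor
    · rintro ⟨u, hu, hu0, huv⟩
      obtain ⟨a, rfl⟩ := (Projectivization.mk_eq_mk_iff' ℝ _ _ _ _).1 huv.symm
      have hpos : ∀ b : ℝ, 0 < b → b • u ∈ interior (K : Set (Fin (n + 1) → ℝ)) := by
        intro b hb
        have := mem_interior_of_mulVec_mem (K := K)
          (A := b • (1 : Matrix (Fin (n + 1)) (Fin (n + 1)) ℝ)) (A' := b⁻¹ • 1)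
          (by rw [smul_mul_smul_comm, inv_mul_cancel₀ hb.ne', one_smul, one_mul])
          (fun x hx => by
            rw [Matrix.smul_mulVec, Matrix.one_mulVec] at hx
            have := K.smul_mem hb.le hx
            rwa [smul_smul, mul_inv_cancel₀ hb.ne', one_smul] at this) hu
        rwa [Matrix.smul_mulVec, Matrix.one_mulVec] at this
      have ha : a ≠ 0 := by rintro rfl; simp at hv
      rcases ha.lt_or_gt with h | h
      · right; rw [← neg_smul]; exact hpos _ (neg_pos.2 h)
      · left; exact hpos _ h
    · rintro (h | h)
      · exact ⟨v, h, hv, rfl⟩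
      · refine ⟨-v, h, neg_ne_zero.2 hv, (Projectivization.mk_eq_mk_iff' ℝ _ _ _ _).2 ⟨-1, ?_⟩⟩
        rw [neg_one_smul]
  convex := by
    rintro p ⟨u, hu, hu0, rfl⟩ q ⟨w, hw, hw0, rfl⟩
    refine ⟨u, w, hu0, hw0, rfl, rfl, fun x hx => ?_⟩
    have hxK := K.convex.interior.segment_subset hu hw hx
    have hx0 : x ≠ 0 := fun h => zero_notMem_interior_of_salient K hs (h ▸ hxK)
    exact ⟨hx0, x, hxK, hx0, rfl⟩
  no_line := by
    rintro _ ⟨W, hW, rfl⟩ hsub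
    have hclosed : IsClosed {x : RP n | ∃ u ∈ K, ∃ hu : u ≠ 0, Projectivization.mk ℝ u hu = x} := by
      rw [isClosed_coinduced]
      have h : IsClosed {v : Fin (n + 1) → ℝ | v ∈ K ∨ -v ∈ K} :=
        hK.union (hK.preimage continuous_neg)
      convert h.preimage continuous_subtype_val using 1
      ext ⟨v, hv⟩
      simp only [Set.mem_preimage, Set.mem_ofPred_eq]
      constructor
      · rintro ⟨u, hu, hu0, huv⟩
        obtain ⟨a, rfl⟩ := (Projectivization.mk_eq_mk_iff' ℝ _ _ _ _).1 huv.symm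
        rcases le_total 0 a with h | h
        · left; exact K.smul_mem h hu
        · right; rw [← neg_smul]; exact K.smul_mem (neg_nonneg.2 h) hu
      · rintro (h | h)
        · exact ⟨v, h, hv, rfl⟩
        · refine ⟨-v, h, neg_ne_zero.2 hv, (Projectivization.mk_eq_mk_iff' ℝ _ _ _ _).2 ⟨-1, ?_⟩⟩
          rw [neg_one_smul]
    have hcl : closure {x : RP n | ∃ u ∈ interior (K : Set (Fin (n + 1) → ℝ)), ∃ hu : u ≠ 0,
        Projectivization.mk ℝ u hu = x} ⊆ _ := closure_minimal (by
      rintro _ ⟨u, hu, hu0, rfl⟩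
      exact ⟨u, interior_subset hu, hu0, rfl⟩) hclosed
    obtain ⟨f, hf⟩ := exists_norm_le_of_salient K hK hs
    -- A functional dominating the norm on `K` vanishes at some non-zero vector of any plane,
    -- whereas a line in the closure would put that vector in `K` up to scaling.
    have hker : LinearMap.ker (f.toLinearMap.domRestrict W) ≠ ⊥ :=
      LinearMap.ker_ne_bot_of_finrank_lt (by rw [hW, Module.finrank_self]; norm_num)
    obtain ⟨⟨w, hwW⟩, hw, hw0⟩ := Submodule.exists_mem_ne_zero_of_ne_bot hker
    have hw0 : w ≠ 0 := fun h => hw0 (Subtype.ext h)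
    have hfw : f w = 0 := hw
    obtain ⟨u, hu, hu0, huw⟩ := hcl (hsub (show (Projectivization.mk ℝ w hw0 : RP n) ∈ _ by
      rw [Set.mem_ofPred_eq, Projectivization.submodule_mk, Submodule.span_singleton_le_iff_mem]
      exact hwW))
    obtain ⟨a, rfl⟩ := (Projectivization.mk_eq_mk_iff' ℝ _ _ _ _).1 huw
    have := hf _ hu
    rw [map_smul, hfw, smul_zero] at this
    exact hu0 (norm_le_zero_iff.1 this)

/-- A matrix representation that preserves a proper cone preserves a properly convex set. -/
theorem projRep_mem_convexReps {r : G →* Matrix (Fin (n + 1)) (Fin (n + 1)) ℝ}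
    (hr : PreservesProperCone r) : projRep r ∈ convexReps G n := by
  obtain ⟨K, hK, hs, ⟨e, he⟩, hinv⟩ := hr
  have hsub : ∀ g, ∀ x ∈ {x : RP n | ∃ u ∈ interior (K : Set (Fin (n + 1) → ℝ)), ∃ hu : u ≠ 0,
      Projectivization.mk ℝ u hu = x}, projRep r g • x ∈ {x : RP n |
      ∃ u ∈ interior (K : Set (Fin (n + 1) → ℝ)), ∃ hu : u ≠ 0,
      Projectivization.mk ℝ u hu = x} := by
    rintro g _ ⟨u, hu, hu0, rfl⟩
    rw [projRep_apply, mk_smul_mk]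
    refine ⟨_, mem_interior_of_mulVec_mem (A := r g) (A' := r g⁻¹) ?_ (fun x hx => ?_) hu, _, rfl⟩
    · rw [← map_mul, inv_mul_cancel, map_one]
    · have := hinv g _ hx
      rwa [Matrix.mulVec_mulVec, ← map_mul, mul_inv_cancel, map_one, Matrix.one_mulVec] at this
  have he0 : e ≠ 0 := fun h => zero_notMem_interior_of_salient K hs (h ▸ he)
  refine ⟨_, isProperlyConvex_image_interior K hK hs, ⟨_, e, he, he0, rfl⟩, fun g => ?_⟩
  refine Set.Subset.antisymm ?_ fun x hx => ⟨projRep r g⁻¹ • x, hsub g⁻¹ x hx, ?_⟩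
  · rintro _ ⟨x, hx, rfl⟩
    exact hsub g x hx
  · change projRep r g • projRep r g⁻¹ • x = x
    rw [smul_smul, ← map_mul, mul_inv_cancel, map_one, one_smul]

end Projective

end ConvexProjective
end

/-! ### Closedness of the set of convex characters. -/

theorem mainTheorem3 (n : ℕ) (G : Type*) [Group G] [Group.FG G] :
    IsClosed (ConvexProjective.chi G n '' ConvexProjective.convexReps G n) := by
  refine isClosed_of_closure_subset fun x hx => ?_
  have := mem_closure_iff_comap_neBot.1 hx
  choose ρ hρ hχ using fun i : (ConvexProjective.chi G n '' ConvexProjective.convexReps G n :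
    Set (ConvexProjective.CharacterVariety G n)) => i.2
  choose r hr hdet hrρ using fun i => ConvexProjective.exists_lift_of_mem_convexReps (hρ i)
  obtain ⟨r₀, hr₀, rfl⟩ := ConvexProjective.exists_preservesProperCone_of_tendsto
    (Filter.comap Subtype.val (nhds x)) hdet hr (by
      simp only [hrρ, hχ]
      exact Filter.tendsto_comap)
  exact ⟨_, ConvexProjective.projRep_mem_convexReps hr₀, rfl⟩
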